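/- Let $\mathcal G=(V,E)$ be a finite, simple, connected, bipartite graph without cut points, embedded in the plane, with bipartition $V=\mathbf B\sqcup\mathbf W$ into black and white vertices; write $e=bw$ for the edge joining $b\in\mathbf B$ and $w\in\mathbf W$. Let $\nu:E\to(0,\infty)$ be edge weights, and assume that $\mathcal G$ has at least one dimer configuration, i.e. a set $C\subset E$ such that each vertex belongs to exactly one edge in $C$. Let $\mathbb P$ be the probability measure on the set $\mathcal C$ of dimer configurations given by $$\mathbb P[C]=\frac1Z\prod_{e\in C}\nu(e),\qquad Z=\sum_{C\in\mathcal C}\prod_{e\in C}\nu(e).$$ Let $s:E\to\mathbb T=\{z\in\mathbb C:|z|=1\}$ be a Kasteleyn sign: for every bounded face, with edges $e_1,\dots,e_{2k}$ in cyclic order, $$\frac{s(e_1)s(e_3)\cdots s(e_{2k-1})}{s(e_2)s(e_4)\cdots s(e_{2k})}=(-1)^{k+1}.$$ Define the Kasteleyn matrix $\mathbb K=(\mathbb K(b,w))_{b\in\mathbf B,\,w\in\mathbf W}$ by $\mathbb K(b,w)=s(bw)\nu(bw)$ if $bw\in E$, and $\mathbb K(b,w)=0$ otherwise. Then $\mathbb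 K$ has a two-sided inverse $\mathbb K^{-1}=(\mathbb K^{-1}(w,b))_{w\in\mathbf W,\,b\in\mathbf B}$, and for every $r\ge 0$ and all distinct edges $e_i=b_iw_i\in E$, $1\le i\le r$, the probability $P(e_1,\dots,e_r)$ that $e_1,\dots,e_r$ all belong to the random dimer configuration is $$P(e_1,\dots,e_r)=\prod_{i=1}^r\mathbb K(b_i,w_i)\,\det\big(\mathbb K^{-1}(w_i,b_j)\big)_{1\le i,j\le r}.$$ Moreover, the dimers form a determinantal point process on $E$ (with the counting measure as reference measure) with correlation kernel $$L(e_i,e_j)=\mathbb K(b_i,w_i)\,\mathbb K^{-1}(w_i,b_j),\qquad e_i=b_iw_i,\ e_j=b_jw_j\in E;$$ that is, for every function $\phi:E\to\mathbb C$, $$\mathbb E\Big[\prod_{e\in C}(1-\phi(e))\Big]=\sum_{n=0}^\infty\frac{(-1)^n}{n!}\sum_{x_1,\dots,x_n\in E}\ \prod_{j=1}^n\phi(x_j)\,\det\big(L(x_i,x_j)\big)_{1\le i,j\le n},$$ where the series converges and the term $n=0$ equals $1$. -/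

import Mathlib

namespace DimerModel

section Planarity

variable {V : Type*} {G : SimpleGraph V}

/-- A rotation system of the graph `G`: for every vertex, a cyclic order of the darts (edges with a
direction) that leave it. The permutation `rot` sends a dart to the next one around its tail. -/
structure RotationSystem (G : SimpleGraph V) where
  rot : Equiv.Perm G.Dart
  rot_fst : ∀ d : G.Dart, (rot d).fst = d.fst
  rot_sameCycle : ∀ d d' : G.Dart, d.fst = d'.fst → rot.SameCycle d d'

/-- Reversal of darts, as a permutation. -/
def dartSymm (G : SimpleGraph V) : Equiv.Perm G.Dart :=
  Function.Involutive.toPerm SimpleGraph.Dart.symm SimpleGraph.Dart.symm_involutive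

/-- The walk along the boundary of a face: after the dart from `u` to `v` comes the dart that
follows the dart from `v` to `u` in the cyclic order around `v`. -/
def RotationSystem.faceNext (R : RotationSystem G) : Equiv.Perm G.Dart :=
  R.rot * dartSymm G

/-- The faces of a rotation system are the cycles of `faceNext`. -/
def RotationSystem.Face (R : RotationSystem G) : Type _ :=
  Quotient (Equiv.Perm.SameCycle.setoid R.faceNext)

/-- The face whose boundary walk passes along the dart `d`. -/
def RotationSystem.face (R : RotationSystem G) (d : G.Dart) : R.Face :=
  Quotient.mk (Equiv.Perm.SameCycle.setoid R.faceNext) d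

/-- An embedding in the plane (up to homeomorphism) of a finite connected graph `G` that has at
least one edge: a rotation system of genus `0`, that is, one which satisfies Euler's relation
`|V| - |E| + |F| = 2`, together with the choice of the outer (unbounded) face. -/
structure PlaneEmbedding (G : SimpleGraph V) extends RotationSystem G where
  euler : (Nat.card V : ℤ) - Nat.card G.edgeSet + Nat.card toRotationSystem.Face = 2
  outer : toRotationSystem.Face

/-- The `i`-th edge on the boundary walk of a face that starts with the dart `d`. -/
def PlaneEmbedding.faceEdge (M : PlaneEmbedding G) (d : G.Dart) (i : ℕ) : G.edgeSet :=
  ⟨(M.faceNext^[i] d).edge, (M.faceNext^[i] d).edge_mem⟩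

/-- The number of edges on the boundary walk of the face of the dart `d`. -/
noncomputable def PlaneEmbedding.faceLength (M : PlaneEmbedding G) (d : G.Dart) : ℕ :=
  Function.minimalPeriod M.faceNext d

/-- Kasteleyn signs: `(s(e₁) s(e₃) ⋯ s(e₂ₖ₋₁)) / (s(e₂) s(e₄) ⋯ s(e₂ₖ)) = (-1)^(k+1)` for every
bounded face with edges `e₁, …, e₂ₖ` in cyclic order (starting at an arbitrary edge). -/
def IsKasteleynSign (M : PlaneEmbedding G) (s : G.edgeSet → Circle) : Prop :=
  ∀ d : G.Dart, M.face d ≠ M.outer → ∀ k : ℕ, M.faceLength d = 2 * k →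
    (∏ i ∈ Finset.range k, (s (M.faceEdge d (2 * i)) : ℂ)) /
      (∏ i ∈ Finset.range k, (s (M.faceEdge d (2 * i + 1)) : ℂ)) = (-1) ^ (k + 1)

/-- No vertex disconnects the graph when it is removed. -/
def NoCutPoints (G : SimpleGraph V) : Prop :=
  ∀ v : V, (G.induce ({v}ᶜ : Set V)).Preconnected

end Planarity

section Dimers

variable {V : Type*} {G : SimpleGraph V}

/-- A dimer configuration (perfect matching): every vertex lies on exactly one edge of `C`. -/
def IsDimerCover (C : Finset G.edgeSet) : Prop :=
  ∀ v : V, ∃! e : G.edgeSet, e ∈ C ∧ v ∈ (e : Sym2 V)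

/-- The weight of a set of edges. -/
def weight (ν : G.edgeSet → ℝ) (C : Finset G.edgeSet) : ℝ :=
  ∏ e ∈ C, ν e

open Classical in
/-- The partition function, the sum of the weights of all dimer configurations. -/
noncomputable def partitionFunction [Fintype G.edgeSet] (ν : G.edgeSet → ℝ) : ℝ :=
  ∑ C : Finset G.edgeSet with IsDimerCover C, weight ν C

open Classical in
/-- The probability of the configuration `C`, as a function on all sets of edges. -/
noncomputable def dimerProb [Fintype G.edgeSet] (ν : G.edgeSet → ℝ) (C : Finset G.edgeSet) : ℝ :=
  if IsDimerCover C then weight ν C / partitionFunction ν else 0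

open Classical in
/-- The probability that all the edges `e₁, …, eᵣ` belong to the random dimer cover. -/
noncomputable def edgeProb [Fintype G.edgeSet] (ν : G.edgeSet → ℝ) {r : ℕ}
    (e : Fin r → G.edgeSet) : ℝ :=
  ∑ C : Finset G.edgeSet with ∀ i, e i ∈ C, dimerProb ν C

open Classical in
/-- The Kasteleyn operator, as a matrix with rows indexed by black and columns by white vertices. -/
noncomputable def kasteleyn (B W : Finset V) (s : G.edgeSet → Circle) (ν : G.edgeSet → ℝ) :
    Matrix B W ℂ :=
  fun b w => if h : G.Adj b w then (s ⟨s(↑b, ↑w), h⟩ : ℂ) * (ν ⟨s(↑b, ↑w), h⟩ : ℂ) else 0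

theorem exists_ends {B W : Finset V} (hG : G.IsBipartiteWith (B : Set V) (W : Set V))
    (e : G.edgeSet) : ∃ p : B × W, (e : Sym2 V) = s((p.1 : V), (p.2 : V)) := by
  obtain ⟨e, he⟩ := e
  induction e using Sym2.ind with
  | _ x y =>
    rcases hG.mem_of_adj (show G.Adj x y from he) with h | h
    · exact ⟨⟨⟨x, h.1⟩, ⟨y, h.2⟩⟩, rfl⟩
    · exact ⟨⟨⟨y, h.2⟩, ⟨x, h.1⟩⟩, Sym2.eq_swap⟩

/-- The black vertex of an edge. -/
noncomputable def blackEnd {B W : Finset V} (hG : G.IsBipartiteWith (B : Set V) (W : Set V))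
    (e : G.edgeSet) : B :=
  (exists_ends hG e).choose.1

/-- The white vertex of an edge. -/
noncomputable def whiteEnd {B W : Finset V} (hG : G.IsBipartiteWith (B : Set V) (W : Set V))
    (e : G.edgeSet) : W :=
  (exists_ends hG e).choose.2

theorem edge_eq_ends {B W : Finset V} (hG : G.IsBipartiteWith (B : Set V) (W : Set V))
    (e : G.edgeSet) : (e : Sym2 V) = s((blackEnd hG e : V), (whiteEnd hG e : V)) :=
  (exists_ends hG e).choose_spec

end Dimers

section PointProcess

variable {X : Type*} [Fintype X]

/-- `P` is the law of a (simple) point process on the finite set `X`, i.e. of a random subset. -/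
def IsPointProcess (P : Finset X → ℝ) : Prop :=
  (∀ C, 0 ≤ P C) ∧ ∑ C, P C = 1

/-- The point process with law `P` has correlation functions `ρ n`, `n ≥ 1`, with respect to the
counting measure: for every `φ`,
`E[∏_{x ∈ C} (1 - φ x)] = 1 + ∑_{n ≥ 1} (-1)^n / n! * ∑_{x₁, …, xₙ} φ x₁ ⋯ φ xₙ * ρ n (x₁, …, xₙ)`,
with a convergent series on the right. -/
def HasCorrelationFunctions (P : Finset X → ℝ) (ρ : (n : ℕ) → (Fin n → X) → ℂ) : Prop :=
  ∀ φ : X → ℂ,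
    HasSum
      (fun n : ℕ => if n = 0 then 1 else
        (-1 : ℂ) ^ n / (n.factorial : ℂ) * ∑ x : Fin n → X, (∏ j, φ (x j)) * ρ n x)
      (∑ C : Finset X, (P C : ℂ) * ∏ x ∈ C, (1 - φ x))

/-- A determinantal point process on the finite set `X` with correlation kernel `L`. -/
def IsDeterminantal (P : Finset X → ℝ) (L : X → X → ℂ) : Prop :=
  IsPointProcess P ∧
    HasCorrelationFunctions P fun n x => Matrix.det (Matrix.of fun i j : Fin n => L (x i) (x j))

end PointProcess

end DimerModel

namespace DimerModel

/-! ### Signs of permutations by counting orbits -/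

section PermutationSigns

open Equiv.Perm

/-! Everything follows from one identity: for arbitrary complex edge weights ζ, the determinant of
the Kasteleyn matrix K_ζ, its columns reindexed by a reference matching, is a nonzero constant times
the sum of ∏ ζ over all dimer covers (`exists_det_kasteleyn_eq`). Taking ζ = ν shows that K = K_ν is
invertible. Taking ζ = ν(1 - φ) and dividing gives E[∏(1 - φ)] = det(1 - K_{νφ} K⁻¹). Factoring
K_{νφ} K⁻¹ through the space of edges turns this into det(1 - φL) (`det_one_sub_mul_inverse`). The
expansion in principal minors is the correlation series (`hasCorrelationFunctions_of_det`), and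
Möbius inversion over subsets identifies the inclusion probabilities with the minors of L
(`sum_superset_eq_minor`).

The determinant identity says that all terms of the Leibniz expansion have the same phase, which is
Kasteleyn's theorem (`sign_mul_prod_kasteleynSign`). Its proof uses no Jordan curves. The difference
of two matchings, oriented from black to white, is a divergence free flow. By Euler's relation it is
the boundary of an integer function n on the faces that vanishes on the outer face
(`exists_int_face_potential`). Let S be the set of faces with n odd. Multiplying the face conditions
with exponents n shows that the ratio of the two products of Kasteleyn signs is (-1)^(|S| + N),
where N counts the darts along S with black tail (`prod_dartSign_zpow`).

The relative sign of the matchings is the same power (`sign_ρ_black`). On the darts along S, the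
face permutation is the product of a vertex rotation, a step along the boundary of S and an edge
involution. Orbit counts give the signs of the face, vertex and edge factors, while the boundary
step carries the relative sign of the matchings. -/

theorem card_image_eq_of_eq_iff {α β γ : Type*} [DecidableEq β] [DecidableEq γ] (s : Finset α)
    (f : α → β) (g : α → γ) (h : ∀ x ∈ s, ∀ y ∈ s, f x = f y ↔ g x = g y) :
    (s.image f).card = (s.image g).card := by
  have hs : ∀ b (hb : b ∈ s.image f), ∃ x ∈ s, f x = b := fun b hb => Finset.mem_image.1 hb
  choose i hi hfi using hs
  refine Finset.card_bij (fun b hb => g (i b hb)) (fun b hb => Finset.mem_image_of_mem _ (hi b hb))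
    ?_ ?_
  · intro b hb c hc hbc
    rw [← hfi b hb, ← hfi c hc]
    exact (h _ (hi b hb) _ (hi c hc)).2 hbc
  · intro c hc
    obtain ⟨x, hx, rfl⟩ := Finset.mem_image.1 hc
    have hb := Finset.mem_image_of_mem f hx
    exact ⟨f x, hb, (h _ (hi _ hb) _ hx).1 (hfi _ hb)⟩

variable {α β : Type*} [Fintype α] [DecidableEq α] [DecidableEq β]

/-- The sign of a permutation from the number of its orbits, which are the fibers of `p`. -/
theorem sign_eq_neg_one_pow_card_orbits (f : Equiv.Perm α) (p : α → β)
    (hp : ∀ x y, p x = p y ↔ f.SameCycle x y) :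
    f.sign = (-1) ^ (Fintype.card α + (Finset.univ.image p).card) := by
  have hcyc : Multiset.card f.cycleType = (f.support.image p).card := by
    rw [cycleType_def, Multiset.card_map]
    have himg : f.cycleFactorsFinset = f.support.image f.cycleOf := by
      ext c
      rw [Finset.mem_image]
      constructor
      · intro hc
        obtain ⟨x, hx⟩ := (mem_cycleFactorsFinset_iff.1 hc).1.nonempty_support
        exact ⟨x, mem_cycleFactorsFinset_support_le hc hx,
          (cycle_is_cycleOf hx hc).symm⟩
      · rintro ⟨x, hx, rfl⟩
        exact cycleOf_mem_cycleFactorsFinset_iff.2 hx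
    change f.cycleFactorsFinset.card = _
    rw [himg]
    refine card_image_eq_of_eq_iff _ _ _ fun x hx y hy => ?_
    rw [hp]
    refine ⟨fun h => ?_, fun h => h.cycleOf_eq⟩
    have hy' : y ∈ (f.cycleOf x).support := by
      rw [h, mem_support_cycleOf_iff]
      exact ⟨SameCycle.refl _ _, hy⟩
    exact (mem_support_cycleOf_iff.1 hy').1
  -- Fixed points are orbits too. They are counted once among the points and once among the orbits,
  -- so they cancel modulo 2.
  have hfix : (f.supportᶜ.image p).card = f.supportᶜ.card := by
    refine Finset.card_image_of_injOn fun x hx y hy hxy => ?_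
    have hx' : f x = x := by simpa using hx
    exact ((hp x y).1 hxy).eq_of_left hx'
  have hdisj : Disjoint (f.support.image p) (f.supportᶜ.image p) := by
    rw [Finset.disjoint_left]
    intro b hb hb'
    obtain ⟨x, hx, rfl⟩ := Finset.mem_image.1 hb
    obtain ⟨y, hy, hxy⟩ := Finset.mem_image.1 hb'
    have hc := (hp y x).1 hxy
    have hy' : f y = y := by simpa using hy
    exact (mem_support.1 hx) (hc.apply_eq_self_iff.1 hy')
  have hunion : (Finset.univ.image p).card = (f.support.image p).card + f.supportᶜ.card := by
    rw [← hfix, ← Finset.card_union_of_disjoint hdisj, ← Finset.image_union,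
      Finset.union_compl]
  rw [sign_of_cycleType, sum_cycleType, hcyc, hunion, ← Finset.card_add_card_compl f.support]
  have : f.support.card + f.supportᶜ.card + ((f.support.image p).card + f.supportᶜ.card) =
      f.support.card + (f.support.image p).card + 2 * f.supportᶜ.card := by ring
  rw [this, pow_add _ _ (2 * _), pow_mul]
  simp

/-- The sign of an involution from its number of `2`-cycles, each of which has exactly one element
that satisfies `P`. -/
theorem sign_involution (f : Equiv.Perm α) (hf : ∀ x, f (f x) = x) (P : α → Prop) [DecidablePred P]
    (hP : ∀ x, f x ≠ x → (P (f x) ↔ ¬ P x)) :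
    f.sign = (-1) ^ (Finset.univ.filter fun x => f x ≠ x ∧ P x).card := by
  have h2 : f ^ 2 = 1 := by ext x; simp [pow_two, hf]
  rw [sign_of_pow_two_eq_one h2, card_fixedPoints, sum_cycleType]
  congr 1
  have hle : f.support.card ≤ Fintype.card α := Finset.card_le_univ _
  have hsplit : f.support.card = (Finset.univ.filter fun x => f x ≠ x ∧ P x).card +
      (Finset.univ.filter fun x => f x ≠ x ∧ ¬ P x).card := by
    rw [← Finset.card_filter_add_card_filter_not (s := f.support) P]
    congr 2 <;> (ext x; simp)
  have heq : (Finset.univ.filter fun x => f x ≠ x ∧ P x).card =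
      (Finset.univ.filter fun x => f x ≠ x ∧ ¬ P x).card := by
    refine Finset.card_bij (fun x _ => f x) ?_ (fun x _ y _ h => f.injective h) ?_
    · intro x hx
      simp only [Finset.mem_filter, Finset.mem_univ, true_and] at hx ⊢
      refine ⟨fun h => hx.1 (f.injective h), fun h => ((hP x hx.1).1 h) hx.2⟩
    · intro x hx
      simp only [Finset.mem_filter, Finset.mem_univ, true_and] at hx
      refine ⟨f x, ?_, hf x⟩
      simp only [Finset.mem_filter, Finset.mem_univ, true_and]
      exact ⟨fun h => hx.1 (f.injective h), (hP x hx.1).2 hx.2⟩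
  omega

end PermutationSigns

/-! ### Principal minors, inclusion probabilities and correlation series -/

section PrincipalMinors

open Finset

variable {X : Type*} [DecidableEq X] {R : Type*} [CommRing R]

/-- Möbius inversion on the lattice of subsets: by strong induction all terms except the top one
cancel. -/
theorem eq_of_sum_powerset_eq {M : Type*} [AddCommGroup M] (a b : Finset X → M)
    (h : ∀ T : Finset X, ∑ S ∈ T.powerset, a S = ∑ S ∈ T.powerset, b S) : a = b := by
  funext T
  induction T using Finset.strongInduction with
  | H T ih =>
    have hT := h T
    rw [← Finset.insert_erase (Finset.mem_powerset_self T),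
      Finset.sum_insert (Finset.notMem_erase _ _), Finset.sum_insert (Finset.notMem_erase _ _)] at hT
    have : ∑ S ∈ T.powerset.erase T, a S = ∑ S ∈ T.powerset.erase T, b S := by
      refine Finset.sum_congr rfl fun S hS => ih S ?_
      rw [Finset.mem_erase, Finset.mem_powerset] at hS
      exact hS.2.ssubset_of_ne hS.1
    rw [this] at hT
    exact add_right_cancel hT

theorem minor_eq_det_of_injective (L : Matrix X X R) {n : ℕ} (x : Fin n → X)
    (hx : Function.Injective x) :
    (L.submatrix (Subtype.val : (Finset.univ.image x) → X) Subtype.val).det =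
      (Matrix.of fun i j => L (x i) (x j)).det := by
  let e : Fin n ≃ (Finset.univ.image x) :=
    Equiv.ofBijective (fun i => ⟨x i, Finset.mem_image_of_mem _ (Finset.mem_univ i)⟩)
      ⟨fun i j h => hx (Subtype.ext_iff.1 h), fun ⟨y, hy⟩ => by
        obtain ⟨i, -, rfl⟩ := Finset.mem_image.1 hy
        exact ⟨i, rfl⟩⟩
  rw [← Matrix.det_submatrix_equiv_self e]
  rfl

variable [Fintype X]

/-- The determinant is multilinear in the rows. Taking the rows in S from A and the others from the
identity leaves the principal minor on S. -/
theorem det_one_add_eq_sum_minors (A : Matrix X X R) :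
    (1 + A).det = ∑ S : Finset X, (A.submatrix (Subtype.val : S → X) Subtype.val).det := by
  rw [add_comm]
  have h := (Matrix.detRowAlternating (R := R) (n := X)).map_add_univ A (1 : Matrix X X R)
  refine Eq.trans (show (A + 1).det = _ from h) ?_
  refine Finset.sum_congr rfl fun S _ => ?_
  rw [← Matrix.det_piecewise_one_eq_submatrix_det]
  rfl

theorem det_one_sub_diagonal_mul (φ : X → R) (L : Matrix X X R) :
    (1 - Matrix.diagonal φ * L).det =
      ∑ S : Finset X, (∏ x ∈ S, -φ x) * (L.submatrix (Subtype.val : S → X) Subtype.val).det := by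
  rw [sub_eq_add_neg, det_one_add_eq_sum_minors]
  refine Finset.sum_congr rfl fun S _ => ?_
  rw [← Finset.prod_coe_sort, ← Matrix.det_mul_column]
  congr 1
  ext i j
  simp [Matrix.diagonal_mul]

/-- The expansion of `E[∏ (1 - φ x)]` in terms of inclusion probabilities. -/
theorem sum_mul_prod_one_sub (P : Finset X → R) (φ : X → R) :
    ∑ C : Finset X, P C * ∏ x ∈ C, (1 - φ x) =
      ∑ S : Finset X, (∏ x ∈ S, -φ x) * ∑ C : Finset X with S ⊆ C, P C := by
  have h1 : ∀ C : Finset X, ∏ x ∈ C, (1 - φ x) = ∑ S ∈ C.powerset, ∏ x ∈ S, -φ x := by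
    intro C
    simp_rw [sub_eq_add_neg, add_comm (1 : R)]
    rw [Finset.prod_add]
    simp
  simp_rw [h1, Finset.mul_sum, Finset.sum_filter]
  rw [Finset.sum_comm' (t' := Finset.univ) (s' := fun S => Finset.univ.filter fun C => S ⊆ C)]
  · refine Finset.sum_congr rfl fun S _ => ?_
    rw [Finset.sum_filter]
    refine Finset.sum_congr rfl fun C _ => ?_
    split_ifs <;> ring
  · simp

/-- If the generating function of a signed measure on finite sets is a Fredholm determinant, then
the inclusion probabilities are the principal minors. -/
theorem sum_superset_eq_minor (P : Finset X → ℂ) (L : Matrix X X ℂ)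
    (h : ∀ φ : X → ℂ, ∑ C : Finset X, P C * ∏ x ∈ C, (1 - φ x) =
      (1 - Matrix.diagonal φ * L).det) (S : Finset X) :
    ∑ C : Finset X with S ⊆ C, P C = (L.submatrix (Subtype.val : S → X) Subtype.val).det := by
  refine congrFun (eq_of_sum_powerset_eq (fun S : Finset X => ∑ C : Finset X with S ⊆ C, P C)
    (fun S => (L.submatrix (Subtype.val : S → X) Subtype.val).det) fun T => ?_) S
  -- For this φ the product of -φ over S is the indicator of S ⊆ T, so both expansions become sums
  -- over the subsets of T and Möbius inversion applies.
  have hT := h fun x => if x ∈ T then -1 else 0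
  rw [sum_mul_prod_one_sub, det_one_sub_diagonal_mul] at hT
  have hprod : ∀ S : Finset X, ∏ x ∈ S, -(if x ∈ T then (-1 : ℂ) else 0) =
      if S ⊆ T then 1 else 0 := by
    intro S
    split_ifs with hS
    · exact Finset.prod_eq_one fun x hx => by simp [hS hx]
    · obtain ⟨x, hx, hxT⟩ := Finset.not_subset.1 hS
      exact Finset.prod_eq_zero hx (by simp [hxT])
  have hpow : T.powerset = Finset.univ.filter fun S => S ⊆ T := by ext; simp
  simp_rw [hprod, ite_mul, one_mul, zero_mul, ← Finset.sum_filter] at hT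
  rw [hpow]
  exact hT

theorem card_embeddings_with_image (S : Finset X) :
    (Finset.univ.filter fun x : Fin S.card → X =>
      Function.Injective x ∧ Finset.univ.image x = S).card = S.card.factorial := by
  have hc : Fintype.card (Fin S.card ≃ S) = S.card.factorial := by
    rw [Fintype.card_equiv S.equivFin.symm]
    simp
  rw [← hc, ← Finset.card_univ]
  symm
  refine Finset.card_bij (fun e _ i => (e i : X)) ?_ ?_ ?_
  · intro e _
    simp only [Finset.mem_filter, Finset.mem_univ, true_and]
    refine ⟨Subtype.val_injective.comp e.injective, ?_⟩
    ext y
    simp only [Finset.mem_image, Finset.mem_univ, true_and]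
    refine ⟨fun ⟨i, hi⟩ => hi ▸ (e i).2, fun hy => ⟨e.symm ⟨y, hy⟩, by simp⟩⟩
  · intro e _ e' _ h
    ext i
    exact congrFun h i
  · intro x hx
    simp only [Finset.mem_filter, Finset.mem_univ, true_and] at hx
    have hmem : ∀ i, x i ∈ S := fun i => hx.2 ▸ Finset.mem_image_of_mem x (Finset.mem_univ i)
    refine ⟨Equiv.ofBijective (fun i => ⟨x i, hmem i⟩) ?_, Finset.mem_univ _, rfl⟩
    rw [Fintype.bijective_iff_injective_and_card]
    exact ⟨fun i j h => hx.1 (Subtype.ext_iff.1 h), by simp⟩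

/-- Each n-element set is the image of n! injective tuples; this factor cancels the 1/n! of the
correlation series. -/
theorem sum_functions_eq_sum_subsets (f : (n : ℕ) → (Fin n → X) → ℂ) (g : Finset X → ℂ) (n : ℕ)
    (h0 : ∀ x : Fin n → X, ¬ Function.Injective x → f n x = 0)
    (hg : ∀ x : Fin n → X, Function.Injective x → f n x = g (Finset.univ.image x)) :
    ∑ x, f n x = n.factorial * ∑ S : Finset X with S.card = n, g S := by
  classical
  have h1 : ∑ x, f n x = ∑ x : Fin n → X with Function.Injective x, g (Finset.univ.image x) := by
    rw [Finset.sum_filter]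
    refine Finset.sum_congr rfl fun x _ => ?_
    split_ifs with hx
    · exact hg x hx
    · exact h0 x hx
  rw [h1, ← Finset.sum_fiberwise_of_maps_to (t := Finset.univ.filter fun S : Finset X => S.card = n)
    (g := fun x => Finset.univ.image x), Finset.mul_sum]
  · refine Finset.sum_congr rfl fun S hS => ?_
    obtain rfl : S.card = n := by simpa using hS
    rw [Finset.sum_congr rfl (g := fun _ => g S), Finset.sum_const, Finset.filter_filter,
      card_embeddings_with_image, nsmul_eq_mul]
    intro x hx
    rw [(Finset.mem_filter.1 hx).2]
  · intro x hx
    have hx' : Function.Injective x := by simpa using hx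
    simp [Finset.card_image_of_injective _ hx']

/-- A tuple with a repetition gives a determinant with two equal rows, so the n-th term is the sum
of the signed minors over n-element sets. The series is finite because such sets exist only for n at
most the size of X. -/
theorem hasCorrelationFunctions_of_det (P : Finset X → ℝ) (L : X → X → ℂ)
    (h : ∀ φ : X → ℂ, ∑ C : Finset X, (P C : ℂ) * ∏ x ∈ C, (1 - φ x) =
      (1 - Matrix.diagonal φ * Matrix.of L).det) :
    HasCorrelationFunctions P fun n x => (Matrix.of fun i j : Fin n => L (x i) (x j)).det := by
  intro φ
  set m : Finset X → ℂ := fun S =>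
    (∏ x ∈ S, φ x) * ((Matrix.of L).submatrix (Subtype.val : S → X) Subtype.val).det with hm
  have hterm : ∀ n : ℕ, (if n = 0 then 1 else (-1 : ℂ) ^ n / (n.factorial : ℂ) *
      ∑ x : Fin n → X, (∏ j, φ (x j)) * (Matrix.of fun i j : Fin n => L (x i) (x j)).det) =
      ∑ S : Finset X with S.card = n, (-1 : ℂ) ^ S.card * m S := by
    intro n
    have hsum : ∑ x : Fin n → X, (∏ j, φ (x j)) *
        (Matrix.of fun i j : Fin n => L (x i) (x j)).det =
        n.factorial * ∑ S : Finset X with S.card = n, m S := by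
      refine sum_functions_eq_sum_subsets (fun n x => (∏ j, φ (x j)) *
        (Matrix.of fun i j : Fin n => L (x i) (x j)).det) m n ?_ ?_
      · intro x hx
        obtain ⟨i, j, hij, hne⟩ := by simpa [Function.Injective] using hx
        refine mul_eq_zero_of_right _ (Matrix.det_zero_of_row_eq hne ?_)
        funext k
        simp [hij]
      · intro x hx
        simp only [hm]
        rw [minor_eq_det_of_injective _ _ hx, Finset.prod_image fun i _ j _ hij => hx hij]
        rfl
    have hfac : (n.factorial : ℂ) ≠ 0 := by exact_mod_cast n.factorial_ne_zero
    have hrhs : ∑ S : Finset X with S.card = n, (-1 : ℂ) ^ S.card * m S =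
        (-1) ^ n * ∑ S : Finset X with S.card = n, m S := by
      rw [Finset.mul_sum]
      exact Finset.sum_congr rfl fun S hS => by rw [(Finset.mem_filter.1 hS).2]
    rw [hrhs]
    split_ifs with hn
    · subst hn
      have : (Finset.univ.filter fun S : Finset X => S.card = 0) = {∅} := by ext; simp
      rw [this]
      simp [hm]
    · rw [hsum]
      field_simp
  simp_rw [hterm]
  have htot : ∑ C : Finset X, (P C : ℂ) * ∏ x ∈ C, (1 - φ x) =
      ∑ n ∈ Finset.range (Fintype.card X + 1),
        ∑ S : Finset X with S.card = n, (-1 : ℂ) ^ S.card * m S := by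
    rw [Finset.sum_fiberwise_of_maps_to
      (fun S _ => Finset.mem_range.2 (Nat.lt_succ_of_le (Finset.card_le_univ S))), h,
      det_one_sub_diagonal_mul]
    refine Finset.sum_congr rfl fun S _ => ?_
    rw [hm, Finset.prod_neg, mul_assoc]
  rw [htot]
  refine hasSum_sum_of_ne_finset_zero fun n hn => Finset.sum_eq_zero fun S hS => ?_
  have h1 := (Finset.mem_filter.1 hS).2
  have h2 := Finset.card_le_univ S
  rw [Finset.mem_range] at hn
  omega

end PrincipalMinors

/-! ### Restriction of permutations to invariant sets -/

section MatchingSigns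

open Equiv.Perm

open scoped Classical in
/-- The permutation that agrees with `f` where `p` holds and is the identity elsewhere. -/
noncomputable def restrictPerm {V : Type*} (f : Equiv.Perm V) (p : V → Prop)
    (hp : ∀ v, p (f v) ↔ p v) : Equiv.Perm V :=
  ofSubtype (subtypePerm f hp)

theorem restrictPerm_of_pos {V : Type*} {f : Equiv.Perm V} {p : V → Prop}
    {hp : ∀ v, p (f v) ↔ p v} {v : V} (hv : p v) : restrictPerm f p hp v = f v := by
  classical
  rw [restrictPerm, ofSubtype_apply_of_mem _ hv]
  rfl

theorem restrictPerm_of_neg {V : Type*} {f : Equiv.Perm V} {p : V → Prop}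
    {hp : ∀ v, p (f v) ↔ p v} {v : V} (hv : ¬ p v) : restrictPerm f p hp v = v := by
  classical
  rw [restrictPerm, ofSubtype_apply_of_not_mem _ hv]

theorem sign_restrictPerm_split {V : Type*} [Fintype V] [DecidableEq V] (f : Equiv.Perm V)
    (p q : V → Prop) (hp : ∀ v, p (f v) ↔ p v) (hq : ∀ v, q (f v) ↔ q v) :
    (restrictPerm f p hp).sign =
      (restrictPerm f (fun v => p v ∧ q v) fun v => and_congr (hp v) (hq v)).sign *
      (restrictPerm f (fun v => p v ∧ ¬ q v) fun v => and_congr (hp v) (not_congr (hq v))).sign := by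
  rw [← Equiv.Perm.sign_mul]
  congr 1
  ext v
  rw [Equiv.Perm.mul_apply]
  by_cases h1 : p v <;> by_cases h2 : q v
  · rw [restrictPerm_of_pos h1, restrictPerm_of_neg (p := fun v => p v ∧ ¬ q v) (by tauto),
      restrictPerm_of_pos (p := fun v => p v ∧ q v) ⟨h1, h2⟩]
  · rw [restrictPerm_of_pos h1, restrictPerm_of_pos (p := fun v => p v ∧ ¬ q v) ⟨h1, h2⟩,
      restrictPerm_of_neg (p := fun v => p v ∧ q v) (by rw [hp, hq]; tauto)]
  · rw [restrictPerm_of_neg h1, restrictPerm_of_neg (p := fun v => p v ∧ ¬ q v) (by tauto),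
      restrictPerm_of_neg (p := fun v => p v ∧ q v) (by tauto)]
  · rw [restrictPerm_of_neg h1, restrictPerm_of_neg (p := fun v => p v ∧ ¬ q v) (by tauto),
      restrictPerm_of_neg (p := fun v => p v ∧ q v) (by tauto)]

theorem sameCycle_invariant {α β : Type*} {f : Equiv.Perm α} {q : α → β}
    (hq : ∀ x, q (f x) = q x) {x y : α} (h : f.SameCycle x y) : q x = q y := by
  obtain ⟨i, rfl⟩ := h
  induction i using Int.induction_on with
  | zero => rfl
  | succ n ih => rw [add_comm, zpow_add, zpow_one, mul_apply, hq, ih]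
  | pred n ih =>
    rw [ih, ← hq ((f ^ (-(n : ℤ) - 1)) x), ← mul_apply, ← zpow_one_add]
    congr 3
    ring

end MatchingSigns

/-! ### Darts and faces of a rotation system -/

section Faces

variable {V : Type*} {G : SimpleGraph V} (R : RotationSystem G)

theorem RotationSystem.faceNext_apply (d : G.Dart) : R.faceNext d = R.rot d.symm := rfl

theorem RotationSystem.faceNext_fst (d : G.Dart) : (R.faceNext d).fst = d.snd := by
  rw [R.faceNext_apply, R.rot_fst]
  rfl

theorem RotationSystem.face_eq_iff {d d' : G.Dart} :
    R.face d = R.face d' ↔ R.faceNext.SameCycle d d' :=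
  Quotient.eq

theorem RotationSystem.face_faceNext (d : G.Dart) : R.face (R.faceNext d) = R.face d :=
  R.face_eq_iff.2 (Equiv.Perm.sameCycle_apply_left.2 (Equiv.Perm.SameCycle.refl _ _))

/-- Rotating d is the same as following the face of the reversed dart by one step. -/
theorem RotationSystem.face_rot (d : G.Dart) : R.face (R.rot d) = R.face d.symm := by
  rw [← R.face_faceNext d.symm, R.faceNext_apply, SimpleGraph.Dart.symm_symm]

theorem RotationSystem.face_surjective : Function.Surjective R.face :=
  Quotient.mk_surjective

end Faces

/-- Two perfect matchings `m₁`, `m₂` of a bipartite graph with a rotation system, given by the darts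
along which every vertex is matched, and a set `S` of faces whose boundary consists of the edges
that lie in exactly one of the matchings. -/
structure MatchingRegion {V : Type*} {G : SimpleGraph V} (R : RotationSystem G) where
  black : V → Prop
  black_snd : ∀ d : G.Dart, black d.snd ↔ ¬ black d.fst
  m₁ : V → G.Dart
  m₂ : V → G.Dart
  m₁_fst : ∀ v, (m₁ v).fst = v
  m₂_fst : ∀ v, (m₂ v).fst = v
  m₁_snd : ∀ v, m₁ (m₁ v).snd = (m₁ v).symm
  m₂_snd : ∀ v, m₂ (m₂ v).snd = (m₂ v).symm
  S : Finset R.Face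
  boundary : ∀ d : G.Dart, (R.face d ∈ S ↔ R.face d.symm ∈ S) ↔ (d = m₁ d.fst ↔ d = m₂ d.fst)

/-! ### The region between two matchings, seen from a vertex -/

namespace MatchingRegion

variable {V : Type*} {G : SimpleGraph V} {R : RotationSystem G} (P : MatchingRegion R)

/-- The dart runs along the boundary of a face in the region. -/
def Inside (d : G.Dart) : Prop := R.face d ∈ P.S

theorem inside_faceNext (d : G.Dart) : P.Inside (R.faceNext d) ↔ P.Inside d := by
  rw [Inside, R.face_faceNext, Inside]

theorem inside_rot (d : G.Dart) : P.Inside (R.rot d) ↔ P.Inside d.symm := by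
  rw [Inside, R.face_rot, Inside]

theorem inside_symm_iff (d : G.Dart) :
    (P.Inside d ↔ P.Inside d.symm) ↔ (d = P.m₁ d.fst ↔ d = P.m₂ d.fst) := P.boundary d

/-- The vertex lies on the boundary of the region. -/
def Bd (v : V) : Prop := P.m₁ v ≠ P.m₂ v

theorem inside_m₁_symm {v : V} (hv : P.Bd v) : P.Inside (P.m₁ v).symm ↔ ¬ P.Inside (P.m₁ v) := by
  have h := P.inside_symm_iff (P.m₁ v)
  rw [P.m₁_fst] at h
  have : P.m₁ v ≠ P.m₂ v := hv
  tauto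

theorem inside_m₂_symm {v : V} (hv : P.Bd v) : P.Inside (P.m₂ v).symm ↔ ¬ P.Inside (P.m₂ v) := by
  have h := P.inside_symm_iff (P.m₂ v)
  rw [P.m₂_fst] at h
  have : P.m₂ v ≠ P.m₁ v := Ne.symm hv
  tauto

theorem inside_rot_of_ne {d : G.Dart} (h₁ : d ≠ P.m₁ d.fst) (h₂ : d ≠ P.m₂ d.fst) :
    P.Inside (R.rot d) ↔ P.Inside d := by
  have := P.inside_symm_iff d
  rw [P.inside_rot]
  tauto

/-- Turn around v starting from m₁. Being inside flips on passing m₁ and afterwards can change only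
at a matched dart. If m₁ and m₂ had the same status, no dart of the opposite status could be
matched, so the flip would persist forever, contradicting that the rotation has finite order. -/
theorem inside_m₂_iff [Finite G.Dart] {v : V} (hv : P.Bd v) :
    P.Inside (P.m₂ v) ↔ ¬ P.Inside (P.m₁ v) := by
  by_contra hcon
  have heq : P.Inside (P.m₂ v) ↔ P.Inside (P.m₁ v) := by tauto
  have key : ∀ k : ℕ, ((R.rot ^ (k + 1)) (P.m₁ v)).fst = v ∧
      (P.Inside ((R.rot ^ (k + 1)) (P.m₁ v)) ↔ ¬ P.Inside (P.m₁ v)) := by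
    intro k
    induction k with
    | zero =>
      rw [zero_add, pow_one, R.rot_fst, P.inside_rot, P.inside_m₁_symm hv]
      exact ⟨P.m₁_fst v, Iff.rfl⟩
    | succ k ih =>
      rw [pow_succ', Equiv.Perm.mul_apply]
      set d := (R.rot ^ (k + 1)) (P.m₁ v)
      obtain ⟨hd, hin⟩ := ih
      rw [R.rot_fst, P.inside_rot_of_ne]
      · exact ⟨hd, hin⟩
      · rw [hd]; intro h; rw [h] at hin; tauto
      · rw [hd]; intro h; rw [h] at hin; tauto
  obtain ⟨n, hn⟩ := Nat.exists_eq_succ_of_ne_zero (orderOf_pos R.rot).ne'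
  have h := (key n).2
  rw [← Nat.succ_eq_add_one, ← hn, pow_orderOf_eq_one] at h
  change (P.Inside (P.m₁ v) ↔ ¬ P.Inside (P.m₁ v)) at h
  tauto

theorem bd_m₁_snd {v : V} : P.Bd (P.m₁ v).snd ↔ P.Bd v := by
  have h : ∀ v, ¬ P.Bd v → ¬ P.Bd (P.m₁ v).snd := by
    intro v hv
    have hv' : P.m₁ v = P.m₂ v := not_not.1 hv
    refine not_not.2 ?_
    rw [P.m₁_snd, hv', P.m₂_snd]
  refine not_iff_not.1 ⟨fun hv => ?_, h v⟩
  have := h _ hv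
  rwa [P.m₁_snd, SimpleGraph.Dart.symm_toProd, Prod.snd_swap, P.m₁_fst] at this

theorem bd_m₂_snd {v : V} : P.Bd (P.m₂ v).snd ↔ P.Bd v := by
  have h : ∀ v, ¬ P.Bd v → ¬ P.Bd (P.m₂ v).snd := by
    intro v hv
    have hv' : P.m₁ v = P.m₂ v := not_not.1 hv
    refine not_not.2 ?_
    rw [P.m₂_snd, ← hv', P.m₁_snd]
  refine not_iff_not.1 ⟨fun hv => ?_, h v⟩
  have := h _ hv
  rwa [P.m₂_snd, SimpleGraph.Dart.symm_toProd, Prod.snd_swap, P.m₂_fst] at this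

/-- The partner of a vertex in the first matching. -/
def μ₁ : Equiv.Perm V :=
  Function.Involutive.toPerm (fun v => (P.m₁ v).snd) fun v => by
    change (P.m₁ (P.m₁ v).snd).snd = v
    rw [P.m₁_snd]
    exact P.m₁_fst v

/-- The partner of a vertex in the second matching. -/
def μ₂ : Equiv.Perm V :=
  Function.Involutive.toPerm (fun v => (P.m₂ v).snd) fun v => by
    change (P.m₂ (P.m₂ v).snd).snd = v
    rw [P.m₂_snd]
    exact P.m₂_fst v

theorem μ₁_apply (v : V) : P.μ₁ v = (P.m₁ v).snd := rfl
theorem μ₂_apply (v : V) : P.μ₂ v = (P.m₂ v).snd := rfl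
theorem μ₁_μ₁ (v : V) : P.μ₁ (P.μ₁ v) = v := Function.Involutive.toPerm_involutive _ v
theorem μ₂_μ₂ (v : V) : P.μ₂ (P.μ₂ v) = v := Function.Involutive.toPerm_involutive _ v
theorem m₁_μ₁ (v : V) : P.m₁ (P.μ₁ v) = (P.m₁ v).symm := P.m₁_snd v
theorem m₂_μ₂ (v : V) : P.m₂ (P.μ₂ v) = (P.m₂ v).symm := P.m₂_snd v
theorem bd_μ₁ {v : V} : P.Bd (P.μ₁ v) ↔ P.Bd v := P.bd_m₁_snd
theorem bd_μ₂ {v : V} : P.Bd (P.μ₂ v) ↔ P.Bd v := P.bd_m₂_snd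

theorem black_μ₁ (v : V) : P.black (P.μ₁ v) ↔ ¬ P.black v := by
  rw [μ₁_apply, P.black_snd, P.m₁_fst]

theorem black_μ₂ (v : V) : P.black (P.μ₂ v) ↔ ¬ P.black v := by
  rw [μ₂_apply, P.black_snd, P.m₂_fst]

/-- Follow the second matching, then the first. -/
def ρ : Equiv.Perm V := P.μ₁ * P.μ₂

theorem ρ_apply (v : V) : P.ρ v = P.μ₁ (P.μ₂ v) := rfl

theorem black_ρ (v : V) : P.black (P.ρ v) ↔ P.black v := by
  rw [ρ_apply, black_μ₁, black_μ₂, not_not]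

theorem ρ_of_not_bd {v : V} (hv : ¬ P.Bd v) : P.ρ v = v := by
  have hv' : P.m₁ v = P.m₂ v := not_not.1 hv
  rw [ρ_apply, μ₂_apply, ← hv', ← μ₁_apply, μ₁_μ₁]

theorem inside_m₂_μ₂ {v : V} (hv : P.Bd v) :
    P.Inside (P.m₂ (P.μ₂ v)) ↔ ¬ P.Inside (P.m₂ v) := by
  rw [m₂_μ₂, P.inside_m₂_symm hv]

variable [Finite G.Dart]

theorem inside_m₂_μ₁ {v : V} (hv : P.Bd v) :
    P.Inside (P.m₂ (P.μ₁ v)) ↔ ¬ P.Inside (P.m₂ v) := by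
  rw [P.inside_m₂_iff (P.bd_μ₁.2 hv), m₁_μ₁, P.inside_m₁_symm hv, P.inside_m₂_iff hv]

/-- At a boundary vertex either partner map reverses the status of the m₂ dart, so their composition
preserves it. -/
theorem inside_m₂_ρ (v : V) : P.Inside (P.m₂ (P.ρ v)) ↔ P.Inside (P.m₂ v) := by
  by_cases hv : P.Bd v
  · rw [ρ_apply, P.inside_m₂_μ₁ (P.bd_μ₂.2 hv), P.inside_m₂_μ₂ hv, not_not]
  · rw [P.ρ_of_not_bd hv]

/-- Split both restrictions by the other predicate; the black inside parts agree. The involution μ₁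
conjugates ρ to its inverse and carries the white inside part to the black outside part, so the
remaining signs agree as well. -/
theorem sign_restrict_inside [Fintype V] [DecidableEq V] :
    (restrictPerm P.ρ (fun v => P.Inside (P.m₂ v)) P.inside_m₂_ρ).sign =
      (restrictPerm P.ρ P.black P.black_ρ).sign := by
  rw [sign_restrictPerm_split P.ρ _ P.black P.inside_m₂_ρ P.black_ρ,
    sign_restrictPerm_split P.ρ _ (fun v => P.Inside (P.m₂ v)) P.black_ρ P.inside_m₂_ρ]
  congr 1
  · congr 3
    ext v
    exact and_comm
  rw [← Equiv.Perm.sign_inv (restrictPerm P.ρ (fun v => P.black v ∧ _) _)]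
  have hne : ∀ (p : V → Prop) (hp) (v : V), restrictPerm P.ρ p hp v ≠ v → p v ∧ P.Bd v := by
    intro p hp v h
    have h1 : p v := by
      by_contra h1
      exact h (restrictPerm_of_neg h1)
    refine ⟨h1, ?_⟩
    by_contra h2
    rw [restrictPerm_of_pos h1] at h
    exact h (P.ρ_of_not_bd h2)
  refine Equiv.Perm.sign_bij (fun v _ => P.μ₁ v) ?_ (fun _ _ _ _ h => P.μ₁.injective h) ?_
  · intro v hv _
    obtain ⟨⟨h1, h2⟩, hbd⟩ := hne _ _ _ hv
    have h3 := restrictPerm_of_pos (f := P.ρ) (p := fun v => P.Inside (P.m₂ v) ∧ ¬ P.black v)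
      (hp := fun v => and_congr (P.inside_m₂_ρ v) (not_congr (P.black_ρ v))) ⟨h1, h2⟩
    rw [Equiv.Perm.eq_inv_iff_eq, h3, ρ_apply, μ₁_μ₁, restrictPerm_of_pos, ρ_apply, μ₂_μ₂]
    exact ⟨(P.black_μ₂ v).2 h2, by rw [P.inside_m₂_μ₂ hbd]; exact not_not.2 h1⟩
  · intro y hy
    have hy' : restrictPerm P.ρ _ _ y ≠ y := fun h => hy (Equiv.Perm.inv_eq_iff_eq.2 h.symm)
    obtain ⟨⟨h1, h2⟩, hbd⟩ := hne _ _ _ hy'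
    refine ⟨P.μ₁ y, ?_, P.μ₁_μ₁ y⟩
    rw [restrictPerm_of_pos ⟨(P.inside_m₂_μ₁ hbd).2 h2, by rw [black_μ₁]; exact not_not.2 h1⟩]
    intro h
    rw [restrictPerm_of_pos ⟨h1, h2⟩] at hy'
    apply hy'
    rw [ρ_apply] at h
    have h3 := P.μ₁.injective h
    have h4 : P.μ₁ y = P.μ₂ y := by rw [← P.μ₂_μ₂ (P.μ₁ y), h3]
    rw [ρ_apply, ← h4, μ₁_μ₁]

end MatchingRegion

/-! ### The factorization of the face permutation of the region -/

namespace MatchingRegion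

open Equiv.Perm

variable {V : Type*} {G : SimpleGraph V} {R : RotationSystem G} (P : MatchingRegion R)

open scoped Classical in
/-- The dart at the same vertex along the other matching, if the dart is matched. -/
noncomputable def otherDart (d : G.Dart) : G.Dart :=
  if d = P.m₁ d.fst then P.m₂ d.fst else if d = P.m₂ d.fst then P.m₁ d.fst else d

theorem otherDart_fst (d : G.Dart) : (P.otherDart d).fst = d.fst := by
  unfold otherDart
  split_ifs <;> simp [m₁_fst, m₂_fst]

theorem otherDart_m₁ (v : V) : P.otherDart (P.m₁ v) = P.m₂ v := by
  simp [otherDart, m₁_fst]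

theorem otherDart_m₂ (v : V) : P.otherDart (P.m₂ v) = P.m₁ v := by
  by_cases h : P.m₂ v = P.m₁ v
  · rw [h, otherDart_m₁, h]
  · simp [otherDart, m₂_fst, h]

theorem otherDart_of_ne {d : G.Dart} (h₁ : d ≠ P.m₁ d.fst) (h₂ : d ≠ P.m₂ d.fst) :
    P.otherDart d = d := by
  simp [otherDart, h₁, h₂]

/-- A dart with the same status on both sides lies in both matchings or in neither, so the swap
moves only boundary darts. -/
theorem otherDart_of_iff {d : G.Dart} (h : P.Inside d ↔ P.Inside d.symm) :
    P.otherDart d = d := by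
  have h' := (P.inside_symm_iff d).1 h
  by_cases h₁ : d = P.m₁ d.fst
  · rw [h₁, otherDart_m₁, ← h'.1 h₁, ← h₁]
  · exact P.otherDart_of_ne h₁ fun h₂ => h₁ (h'.2 h₂)

theorem eq_m₁_or_eq_m₂ {d : G.Dart} (h : ¬ (P.Inside d ↔ P.Inside d.symm)) :
    P.Bd d.fst ∧ (d = P.m₁ d.fst ∨ d = P.m₂ d.fst) := by
  have h' := (not_congr (P.inside_symm_iff d)).1 h
  refine ⟨fun heq => h' ?_, by tauto⟩
  rw [heq]

theorem otherDart_otherDart (d : G.Dart) : P.otherDart (P.otherDart d) = d := by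
  by_cases h₁ : d = P.m₁ d.fst
  · rw [h₁, otherDart_m₁, otherDart_m₂]
  by_cases h₂ : d = P.m₂ d.fst
  · rw [h₂, otherDart_m₂, otherDart_m₁]
  rw [P.otherDart_of_ne h₁ h₂, P.otherDart_of_ne h₁ h₂]

/-- The rotation system, with the rotation at every boundary vertex split at the two matched
darts. -/
noncomputable def splitRot : Equiv.Perm G.Dart :=
  R.rot * Function.Involutive.toPerm P.otherDart P.otherDart_otherDart

theorem splitRot_apply (d : G.Dart) : P.splitRot d = R.rot (P.otherDart d) := rfl

theorem splitRot_fst (d : G.Dart) : (P.splitRot d).fst = d.fst := by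
  rw [splitRot_apply, R.rot_fst, otherDart_fst]

/-- The darts along the faces of the region. -/
abbrev InsideDart : Type _ := {d : G.Dart // P.Inside d}

/-- The face permutation of the region. -/
def regionFace : Equiv.Perm P.InsideDart := subtypePerm R.faceNext P.inside_faceNext

open scoped Classical in
/-- The edge involution of the region. -/
noncomputable def regionEdge : Equiv.Perm P.InsideDart :=
  Function.Involutive.toPerm
    (fun d => if h : P.Inside d.1.symm then ⟨d.1.symm, h⟩ else d) fun d => by
      by_cases h : P.Inside d.1.symm
      · have h' : P.Inside d.1.symm.symm := by simpa using d.2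
        simp only [h, dif_pos, h']
        exact Subtype.ext d.1.symm_symm
      · simp [h]

theorem regionEdge_of_pos {d : P.InsideDart} (h : P.Inside d.1.symm) :
    P.regionEdge d = ⟨d.1.symm, h⟩ := by
  classical
  change dite _ _ _ = _
  rw [dif_pos h]

theorem regionEdge_of_neg {d : P.InsideDart} (h : ¬ P.Inside d.1.symm) :
    P.regionEdge d = d := by
  classical
  change dite _ _ _ = _
  rw [dif_neg h]

theorem regionEdge_regionEdge (d : P.InsideDart) : P.regionEdge (P.regionEdge d) = d :=
  P.regionEdge.symm_apply_apply d

theorem regionEdge_inv : P.regionEdge⁻¹ = P.regionEdge := rfl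

section FiniteDarts

variable [Finite G.Dart]

theorem inside_splitRot (d : G.Dart) : P.Inside (P.splitRot d) ↔ P.Inside d := by
  rw [splitRot_apply, inside_rot]
  by_cases h : P.Inside d ↔ P.Inside d.symm
  · rw [P.otherDart_of_iff h, h]
  · obtain ⟨hbd, h₁ | h₁⟩ := P.eq_m₁_or_eq_m₂ h
    · rw [h₁, otherDart_m₁, P.inside_m₂_symm hbd, P.inside_m₂_iff hbd, not_not]
    · rw [h₁, otherDart_m₂, P.inside_m₁_symm hbd, P.inside_m₂_iff hbd]

/-- Rotation from d eventually reaches m₁. Up to the first matched dart the swap does nothing, so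
the split rotation takes the same steps and stays inside. -/
theorem exists_sameCycle_splitRot {d : G.Dart} (hd : P.Inside d) :
    ∃ j, (j = P.m₁ d.fst ∨ j = P.m₂ d.fst) ∧ P.Inside j ∧ P.splitRot.SameCycle d j := by
  obtain ⟨k, hk⟩ := (R.rot_sameCycle d (P.m₁ d.fst) (P.m₁_fst _).symm).exists_nat_pow_eq
  induction k generalizing d with
  | zero => exact ⟨d, Or.inl hk, hd, SameCycle.refl _ _⟩
  | succ k ih =>
    by_cases h₁ : d = P.m₁ d.fst
    · exact ⟨d, Or.inl h₁, hd, SameCycle.refl _ _⟩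
    by_cases h₂ : d = P.m₂ d.fst
    · exact ⟨d, Or.inr h₂, hd, SameCycle.refl _ _⟩
    have hs : P.splitRot d = R.rot d := by rw [splitRot_apply, P.otherDart_of_ne h₁ h₂]
    have hd' : P.Inside (P.splitRot d) := (P.inside_splitRot d).2 hd
    obtain ⟨j, hj, hin, hc⟩ := ih hd' (by rw [splitRot_fst, hs, ← hk, pow_succ, mul_apply])
    rw [splitRot_fst] at hj
    exact ⟨j, hj, hin, sameCycle_apply_left.1 hc⟩

/-- Every inside dart is in the cycle of an inside matched dart. At a boundary vertex exactly one of
the two matched darts is inside, and elsewhere they coincide, so the inside darts at a vertex form a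
single cycle. -/
theorem sameCycle_splitRot_iff {d d' : G.Dart} (hd : P.Inside d) (hd' : P.Inside d') :
    d.fst = d'.fst ↔ P.splitRot.SameCycle d d' := by
  refine ⟨fun h => ?_, fun h => sameCycle_invariant (q := fun d => d.fst) P.splitRot_fst h⟩
  obtain ⟨j, hj, hin, hc⟩ := P.exists_sameCycle_splitRot hd
  obtain ⟨j', hj', hin', hc'⟩ := P.exists_sameCycle_splitRot hd'
  rw [← h] at hj'
  have hjj : j = j' := by
    by_cases hbd : P.Bd d.fst
    · have h2 := P.inside_m₂_iff hbd
      rcases hj with rfl | rfl <;> rcases hj' with rfl | rfl <;> tauto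
    · have heq : P.m₁ d.fst = P.m₂ d.fst := not_not.1 hbd
      rcases hj with rfl | rfl <;> rcases hj' with rfl | rfl <;> simp [heq]
  subst hjj
  exact hc.trans hc'.symm

theorem boundary_dart_unique {d d' : G.Dart} (h₁ : P.Inside d) (h₂ : ¬ P.Inside d.symm)
    (h₁' : P.Inside d') (h₂' : ¬ P.Inside d'.symm) (h : d.fst = d'.fst) : d = d' := by
  obtain ⟨hbd, hd⟩ := P.eq_m₁_or_eq_m₂ (d := d) (by tauto)
  obtain ⟨-, hd'⟩ := P.eq_m₁_or_eq_m₂ (d := d') (by tauto)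
  rw [← h] at hd'
  have h2 := P.inside_m₂_iff hbd
  generalize P.m₁ d.fst = a at *
  generalize P.m₂ d.fst = b at *
  rcases hd with rfl | rfl <;> rcases hd' with rfl | rfl <;> tauto

theorem exists_boundary_dart {v : V} (hv : P.Bd v) :
    ∃ d, d.fst = v ∧ P.Inside d ∧ ¬ P.Inside d.symm := by
  by_cases h : P.Inside (P.m₁ v)
  · exact ⟨P.m₁ v, P.m₁_fst v, h, fun h' => (P.inside_m₁_symm hv).1 h' h⟩
  · have h2 := (P.inside_m₂_iff hv).2 h
    exact ⟨P.m₂ v, P.m₂_fst v, h2, fun h' => (P.inside_m₂_symm hv).1 h' h2⟩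

/-- The vertex permutation of the region. -/
noncomputable def regionVertex : Equiv.Perm P.InsideDart :=
  subtypePerm P.splitRot P.inside_splitRot

/-- The step along the boundary of the region. -/
noncomputable def regionStep : Equiv.Perm P.InsideDart :=
  P.regionVertex⁻¹ * P.regionFace * P.regionEdge⁻¹

theorem regionFace_eq : P.regionFace = P.regionVertex * P.regionStep * P.regionEdge := by
  simp [regionStep, mul_assoc]

theorem regionStep_of_pos {d : P.InsideDart} (h : P.Inside d.1.symm) : P.regionStep d = d := by
  rw [regionStep, regionEdge_inv, mul_apply, mul_apply, inv_eq_iff_eq, P.regionEdge_of_pos h]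
  apply Subtype.ext
  change R.faceNext d.1.symm = P.splitRot d.1
  rw [splitRot_apply, P.otherDart_of_iff (iff_of_true d.2 h), R.faceNext_apply,
    SimpleGraph.Dart.symm_symm]

/-- At the head of a boundary dart the boundary of the region continues along the other matching;
interior darts are fixed by the step. -/
theorem regionStep_of_neg {d : P.InsideDart} (h : ¬ P.Inside d.1.symm) :
    (P.regionStep d).1 = P.otherDart d.1.symm := by
  have hin : P.Inside (P.otherDart d.1.symm) := by
    rw [← P.inside_splitRot, splitRot_apply, otherDart_otherDart, inside_rot,
      SimpleGraph.Dart.symm_symm]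
    exact d.2
  have : P.regionStep d = ⟨_, hin⟩ := by
    rw [regionStep, regionEdge_inv, mul_apply, mul_apply, inv_eq_iff_eq, P.regionEdge_of_neg h]
    apply Subtype.ext
    change R.faceNext d.1 = P.splitRot (P.otherDart d.1.symm)
    rw [splitRot_apply, otherDart_otherDart, R.faceNext_apply]
  rw [this]

/-- The first matching on the boundary of the region, the identity elsewhere. -/
noncomputable def boundaryMatching : Equiv.Perm V := restrictPerm P.μ₁ P.Bd fun _ => P.bd_μ₁

end FiniteDarts

/-! ### Signs of the factors -/

section Signs

variable [Fintype V] [DecidableEq V] [DecidableRel G.Adj]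

open scoped Classical

theorem sign_regionFace :
    P.regionFace.sign = (-1) ^ (Fintype.card P.InsideDart + P.S.card) := by
  rw [sign_eq_neg_one_pow_card_orbits P.regionFace (fun d => R.face d.1)]
  · congr 3
    ext f
    simp only [Finset.mem_image, Finset.mem_univ, true_and]
    constructor
    · rintro ⟨d, rfl⟩
      exact d.2
    · intro hf
      obtain ⟨d, rfl⟩ := R.face_surjective f
      exact ⟨⟨d, hf⟩, rfl⟩
  · intro d d'
    rw [R.face_eq_iff]
    exact sameCycle_subtypePerm.symm

/-- The orbits correspond to the vertices that touch the region. A vertex touches it iff one of the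
two sides of its m₁ edge is inside, a condition shared by its m₁ partner. These vertices are
therefore paired black with white and even in number. -/
theorem sign_regionVertex :
    P.regionVertex.sign = (-1) ^ Fintype.card P.InsideDart := by
  rw [sign_eq_neg_one_pow_card_orbits P.regionVertex (fun d => d.1.fst), pow_add]
  · refine mul_eq_left.2 (Even.neg_one_pow ?_)
    set T : Finset V := Finset.univ.image fun d : P.InsideDart => d.1.fst with hT
    have hmem : ∀ v, v ∈ T ↔ P.Inside (P.m₁ v) ∨ P.Inside (P.m₁ v).symm := by
      intro v
      simp only [hT, Finset.mem_image, Finset.mem_univ, true_and]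
      constructor
      · rintro ⟨d, rfl⟩
        by_cases hbd : P.Bd d.1.fst
        · rw [P.inside_m₁_symm hbd]
          exact em _
        · obtain ⟨j, hj, hin, -⟩ := P.exists_sameCycle_splitRot d.2
          rw [← (not_not.1 hbd : P.m₁ d.1.fst = P.m₂ d.1.fst), or_self] at hj
          exact Or.inl (hj ▸ hin)
      · rintro (h | h)
        · exact ⟨⟨_, h⟩, P.m₁_fst v⟩
        · exact ⟨⟨_, (P.inside_rot _).2 h⟩, by rw [R.rot_fst, P.m₁_fst]⟩
    have hμ : ∀ v, v ∈ T → P.μ₁ v ∈ T := by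
      intro v hv
      rw [hmem, m₁_μ₁, SimpleGraph.Dart.symm_symm]
      exact ((hmem v).1 hv).symm
    rw [← Finset.card_filter_add_card_filter_not P.black]
    have : (T.filter P.black).card = (T.filter fun v => ¬ P.black v).card := by
      refine Finset.card_nbij' P.μ₁ P.μ₁ ?_ ?_ (fun v _ => P.μ₁_μ₁ v) (fun v _ => P.μ₁_μ₁ v)
      · intro v hv
        simp only [Finset.coe_filter, Set.mem_ofPred_eq, black_μ₁] at hv ⊢
        exact ⟨hμ v hv.1, not_not.2 hv.2⟩
      · intro v hv
        simp only [Finset.coe_filter, Set.mem_ofPred_eq, black_μ₁] at hv ⊢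
        exact ⟨hμ v hv.1, hv.2⟩
    rw [this]
    exact Even.add_self _
  · intro d d'
    rw [P.sameCycle_splitRot_iff d.2 d'.2]
    exact sameCycle_subtypePerm.symm

/-- The 2-cycles are the edges with both sides in the region, each counted by its dart with black
tail. -/
theorem sign_regionEdge :
    P.regionEdge.sign = (-1) ^ (Finset.univ.filter fun d : G.Dart =>
      (P.Inside d ∧ P.black d.fst) ∧ P.Inside d.symm).card := by
  rw [sign_involution P.regionEdge P.regionEdge_regionEdge
    (fun d => P.black d.1.fst)]
  · congr 1
    refine Finset.card_bij (fun d _ => d.1) ?_ (fun _ _ _ _ h => Subtype.ext h) ?_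
    · intro d hd
      simp only [Finset.mem_filter, Finset.mem_univ, true_and] at hd ⊢
      refine ⟨⟨d.2, hd.2⟩, ?_⟩
      by_contra h
      exact hd.1 (P.regionEdge_of_neg h)
    · intro d hd
      simp only [Finset.mem_filter, Finset.mem_univ, true_and] at hd
      refine ⟨⟨d, hd.1.1⟩, ?_, rfl⟩
      simp only [Finset.mem_filter, Finset.mem_univ, true_and]
      refine ⟨?_, hd.1.2⟩
      rw [P.regionEdge_of_pos (d := ⟨d, hd.1.1⟩) hd.2]
      exact fun h => d.symm_ne (Subtype.ext_iff.1 h)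
  · intro d hd
    have h : P.Inside d.1.symm := by
      by_contra h
      exact hd (P.regionEdge_of_neg h)
    rw [P.regionEdge_of_pos h]
    exact P.black_snd d.1

/-- The 2-cycles are counted by the black boundary vertices, and each of these is the tail of
exactly one inside dart whose reverse is outside. -/
theorem sign_boundaryMatching :
    P.boundaryMatching.sign = (-1) ^ (Finset.univ.filter fun d : G.Dart =>
      (P.Inside d ∧ P.black d.fst) ∧ ¬ P.Inside d.symm).card := by
  have hne : ∀ v, P.boundaryMatching v ≠ v ↔ P.Bd v := by
    intro v
    by_cases hv : P.Bd v
    · rw [boundaryMatching, restrictPerm_of_pos hv, iff_true_right hv, μ₁_apply]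
      intro h
      have := (P.m₁ v).fst_ne_snd
      rw [h, m₁_fst] at this
      exact this rfl
    · rw [boundaryMatching, restrictPerm_of_neg hv]
      tauto
  rw [sign_involution P.boundaryMatching ?_ P.black]
  · congr 1
    symm
    refine Finset.card_bij (fun d _ => d.fst) ?_ ?_ ?_
    · intro d hd
      simp only [Finset.mem_filter, Finset.mem_univ, true_and, hne] at hd ⊢
      exact ⟨(P.eq_m₁_or_eq_m₂ (by tauto)).1, hd.1.2⟩
    · intro d hd d' hd' h
      simp only [Finset.mem_filter, Finset.mem_univ, true_and] at hd hd'
      exact P.boundary_dart_unique hd.1.1 hd.2 hd'.1.1 hd'.2 h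
    · intro v hv
      simp only [Finset.mem_filter, Finset.mem_univ, true_and, hne] at hv
      obtain ⟨d, rfl, hd, hd'⟩ := P.exists_boundary_dart hv.1
      exact ⟨d, by simp [hd, hd', hv.2], rfl⟩
  · intro v hv
    rw [hne] at hv
    rw [boundaryMatching, restrictPerm_of_pos hv, black_μ₁]
  · intro v
    by_cases hv : P.Bd v
    · rw [boundaryMatching, restrictPerm_of_pos hv, restrictPerm_of_pos (P.bd_μ₁.2 hv), μ₁_μ₁]
    · rw [boundaryMatching, restrictPerm_of_neg hv, restrictPerm_of_neg hv]

/-- Tails identify boundary darts with boundary vertices, and the step becomes the map from tail to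
head. This head is μ₂ v if the m₂ dart is inside and μ₁ v otherwise, that is, μ₁ applied after ρ or
after the identity. -/
theorem sign_regionStep :
    P.regionStep.sign = P.boundaryMatching.sign *
      (restrictPerm P.ρ (fun v => P.Inside (P.m₂ v)) P.inside_m₂_ρ).sign := by
  rw [← Equiv.Perm.sign_mul]
  have hstep : ∀ d : P.InsideDart, P.regionStep d ≠ d → ¬ P.Inside d.1.symm :=
    fun d hd h => hd (P.regionStep_of_pos h)
  have hval : ∀ d : G.Dart, P.Inside d → ¬ P.Inside d.symm →
      (P.boundaryMatching * restrictPerm P.ρ (fun v => P.Inside (P.m₂ v)) P.inside_m₂_ρ) d.fst =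
        d.snd := by
    intro d hd hd'
    obtain ⟨hbd, h⟩ := P.eq_m₁_or_eq_m₂ (d := d) (by tauto)
    rw [Equiv.Perm.mul_apply]
    rcases h with h | h
    · rw [restrictPerm_of_neg (by rw [P.inside_m₂_iff hbd, ← h]; exact not_not.2 hd),
        boundaryMatching, restrictPerm_of_pos hbd, μ₁_apply, ← h]
    · rw [restrictPerm_of_pos (p := fun v => P.Inside (P.m₂ v)) (by rwa [← h]),
        boundaryMatching, ρ_apply, restrictPerm_of_pos (P.bd_μ₁.2 (P.bd_μ₂.2 hbd)), μ₁_μ₁,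
        μ₂_apply, ← h]
  refine Equiv.Perm.sign_bij (fun d _ => d.1.fst) ?_ ?_ ?_
  · intro d hd _
    rw [hval d.1 d.2 (hstep d hd), P.regionStep_of_neg (hstep d hd), otherDart_fst]
    rfl
  · intro d d' hd hd' h
    exact Subtype.ext (P.boundary_dart_unique d.2 (hstep d hd) d'.2 (hstep d' hd') h)
  · intro v hv
    have hbd : P.Bd v := by
      by_contra hbd
      apply hv
      have h : restrictPerm P.ρ (fun v => P.Inside (P.m₂ v)) P.inside_m₂_ρ v = v := by
        by_cases hin : P.Inside (P.m₂ v)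
        · rw [restrictPerm_of_pos (p := fun v => P.Inside (P.m₂ v)) hin, P.ρ_of_not_bd hbd]
        · rw [restrictPerm_of_neg (p := fun v => P.Inside (P.m₂ v)) hin]
      rw [Equiv.Perm.mul_apply, h, boundaryMatching, restrictPerm_of_neg hbd]
    obtain ⟨d, rfl, hd, hd'⟩ := P.exists_boundary_dart hbd
    refine ⟨⟨d, hd⟩, ?_, rfl⟩
    intro h
    have := congrArg (fun e : P.InsideDart => e.1.fst) h
    simp only [P.regionStep_of_neg (d := ⟨d, hd⟩) hd', otherDart_fst] at this
    exact d.snd_ne_fst this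

/-- The relative sign of two matchings in terms of the region between them. -/
theorem sign_ρ_black :
    (restrictPerm P.ρ P.black P.black_ρ).sign =
      (-1) ^ (P.S.card + (Finset.univ.filter fun d : G.Dart =>
        P.Inside d ∧ P.black d.fst).card) := by
  have h := congrArg Equiv.Perm.sign P.regionFace_eq
  rw [Equiv.Perm.sign_mul, Equiv.Perm.sign_mul, sign_regionFace, sign_regionVertex,
    sign_regionStep, sign_regionEdge, sign_boundaryMatching, sign_restrict_inside, pow_add] at h
  rw [← Finset.card_filter_add_card_filter_not (s := Finset.univ.filter fun d : G.Dart =>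
    P.Inside d ∧ P.black d.fst) fun d => P.Inside d.symm, Finset.filter_filter,
    Finset.filter_filter, pow_add, pow_add]
  rw [mul_assoc] at h
  -- The number of inside darts occurs for both faces and vertices and cancels. Interior and
  -- boundary edges together account for all inside darts with black tail.
  rw [mul_left_cancel h]
  have hsq : ∀ n : ℕ, ((-1 : ℤˣ) ^ n) * (-1) ^ n = 1 := fun n => by
    rw [← mul_pow]; simp
  set a := (-1 : ℤˣ) ^ (Finset.univ.filter fun d : G.Dart =>
    (P.Inside d ∧ P.black d.fst) ∧ P.Inside d.symm).card with ha
  set b := (-1 : ℤˣ) ^ (Finset.univ.filter fun d : G.Dart =>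
    (P.Inside d ∧ P.black d.fst) ∧ ¬ P.Inside d.symm).card with hb
  have haa : a * a = 1 := hsq _
  have hbb : b * b = 1 := hsq _
  calc _ = (b * b) * (a * a) * (restrictPerm P.ρ P.black P.black_ρ).sign := by rw [haa, hbb]; simp
    _ = _ := by ac_rfl

end Signs

end MatchingRegion

/-! ### Divergence free flows on a sphere -/

section Homology

variable {V : Type*} {G : SimpleGraph V}

/-- In a connected graph, reversal and rotation act transitively on the darts. -/
theorem dart_induction [Finite G.Dart] (R : RotationSystem G) (hconn : G.Preconnected)
    {p : G.Dart → Prop} (hsymm : ∀ d, p d → p d.symm) (hrot : ∀ d, p d → p (R.rot d))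
    {d₀ : G.Dart} (h₀ : p d₀) (d : G.Dart) : p d := by
  have hvertex : ∀ d d' : G.Dart, d.fst = d'.fst → p d → p d' := by
    intro d d' h hd
    obtain ⟨k, rfl⟩ := (R.rot_sameCycle d d' h).exists_nat_pow_eq
    clear h
    induction k with
    | zero => exact hd
    | succ k ih => rw [pow_succ', Equiv.Perm.mul_apply]; exact hrot _ ih
  have hwalk : ∀ (u v : V) (w : G.Walk u v), (∀ d : G.Dart, d.fst = u → p d) →
      ∀ d : G.Dart, d.fst = v → p d := by
    intro u v w
    induction w with
    | nil => exact id
    | cons h _ ih =>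
      intro hu
      refine ih fun d hd => hvertex (SimpleGraph.Dart.symm ⟨(_, _), h⟩) d hd.symm ?_
      exact hsymm _ (hu _ rfl)
  obtain ⟨w⟩ := hconn d₀.fst d.fst
  exact hwalk _ _ w (fun d' hd' => hvertex d₀ d' hd'.symm h₀) d rfl

variable [Fintype V] [DecidableRel G.Adj] (M : PlaneEmbedding G)
  {black : V → Prop}

open scoped Classical

theorem sum_dart_eq_sum_black {A : Type*} [AddCommMonoid A]
    (hblack : ∀ d : G.Dart, black d.snd ↔ ¬ black d.fst) (f : G.Dart → A) :
    ∑ d, f d = ∑ d : {d : G.Dart // black d.fst}, (f d + f d.1.symm) := by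
  rw [Finset.sum_add_distrib, ← Finset.sum_filter_add_sum_filter_not Finset.univ
    (fun d : G.Dart => black d.fst)]
  congr 1
  · exact Finset.sum_subtype _ (by simp) _
  · rw [← Finset.sum_subtype (Finset.univ.filter fun d : G.Dart => black d.fst) (by simp)
      (fun d => f d.symm)]
    refine Finset.sum_nbij' SimpleGraph.Dart.symm SimpleGraph.Dart.symm ?_ ?_ ?_ ?_ ?_
    · intro d hd
      simp only [Finset.mem_filter, Finset.mem_univ, true_and] at hd ⊢
      exact (hblack d).2 hd
    · intro d hd
      simp only [Finset.mem_filter, Finset.mem_univ, true_and] at hd ⊢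
      exact fun h => (hblack d).1 h hd
    · simp
    · simp
    · simp

/-- Summation by parts: with one dart per edge, a gradient is orthogonal to an antisymmetric flow
when the potential pairs to zero with its divergence. -/
theorem sum_grad_mul_eq_zero (hblack : ∀ d : G.Dart, black d.snd ↔ ¬ black d.fst)
    (g : V → ℚ) (q : G.Dart → ℚ) (hanti : ∀ d, q d.symm = -q d)
    (hdiv : ∑ d, g d.fst * q d = 0) :
    ∑ d : {d : G.Dart // black d.fst}, (g d.1.snd - g d.1.fst) * q d = 0 := by
  rw [sum_dart_eq_sum_black hblack] at hdiv
  rw [← neg_eq_zero, ← Finset.sum_neg_distrib, ← hdiv]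
  refine Finset.sum_congr rfl fun d _ => ?_
  rw [hanti]
  change _ = _ + g d.1.snd * _
  ring

/-- Face boundaries are divergence free: rotating about the tail exchanges the two face terms and
preserves the vertex factor. -/
theorem sum_fst_mul_face_sub_eq_zero (R : RotationSystem G) (g : V → ℚ) (n : R.Face → ℚ) :
    ∑ d : G.Dart, g d.fst * (n (R.face d) - n (R.face d.symm)) = 0 := by
  simp_rw [mul_sub, Finset.sum_sub_distrib]
  rw [sub_eq_zero, ← Equiv.sum_comp R.rot]
  refine Finset.sum_congr rfl fun d _ => ?_
  rw [R.rot_fst, R.face_rot]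

/-- On a sphere, every divergence free flow is the boundary of a combination of faces. -/
theorem exists_rat_face_potential (hconn : G.Connected)
    (hblack : ∀ d : G.Dart, black d.snd ↔ ¬ black d.fst)
    (c : G.Dart → ℚ) (hanti : ∀ d, c d.symm = -c d)
    (hdiv : ∀ v, ∑ d : G.Dart with d.fst = v, c d = 0) :
    ∃ n : M.Face → ℚ, ∀ d, c d = n (M.face d) - n (M.face d.symm) := by
  have hfin : Finite M.Face := Finite.of_surjective _ M.face_surjective
  let _ : Fintype M.Face := Fintype.ofFinite _
  let T : (M.Face → ℚ) → G.Dart → ℚ := fun n d => n (M.face d) - n (M.face d.symm)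
  -- Gradients plus face boundaries. The source has dimension |V| + |F|, which Euler's relation
  -- makes |E| + 2, and the target has dimension |E|. Surjectivity thus reduces to a kernel of
  -- dimension at most 2.
  let Φ : ((V → ℚ) × (M.Face → ℚ)) →ₗ[ℚ] ({d : G.Dart // black d.fst} → ℚ) :=
    { toFun := fun x d => (x.1 d.1.snd - x.1 d.1.fst) + T x.2 d
      map_add' := fun x y => by ext d; simp [T]; ring
      map_smul' := fun a x => by ext d; simp [T]; ring }
  have hTanti : ∀ n d, T n d.symm = -T n d := fun n d => by simp [T]
  have horth : ∀ (g : V → ℚ) (n : M.Face → ℚ),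
      ∑ d : {d : G.Dart // black d.fst}, (g d.1.snd - g d.1.fst) * T n d = 0 :=
    fun g n => sum_grad_mul_eq_zero hblack g _ (hTanti n)
      (sum_fst_mul_face_sub_eq_zero M.toRotationSystem g n)
  have hker : ∀ x, Φ x = 0 → (∀ d : {d : G.Dart // black d.fst}, x.1 d.1.snd = x.1 d.1.fst) ∧
      ∀ d : {d : G.Dart // black d.fst}, T x.2 d = 0 := by
    intro x hx
    have hx' : ∀ d : {d : G.Dart // black d.fst}, (x.1 d.1.snd - x.1 d.1.fst) + T x.2 d = 0 :=
      fun d => congrFun hx d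
    have h0 : ∑ d : {d : G.Dart // black d.fst},
        (x.1 d.1.snd - x.1 d.1.fst) * (x.1 d.1.snd - x.1 d.1.fst) = 0 := by
      rw [← neg_eq_zero, ← Finset.sum_neg_distrib, ← horth x.1 x.2]
      refine Finset.sum_congr rfl fun d _ => ?_
      rw [eq_neg_of_add_eq_zero_right (hx' d)]
      ring
    have h1 : ∀ d : {d : G.Dart // black d.fst}, x.1 d.1.snd - x.1 d.1.fst = 0 := fun d =>
      mul_self_eq_zero.1
        ((Finset.sum_eq_zero_iff_of_nonneg fun d _ => mul_self_nonneg _).1 h0 d (Finset.mem_univ _))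
    exact ⟨fun d => sub_eq_zero.1 (h1 d), fun d => by simpa [h1 d] using hx' d⟩
  obtain ⟨d₀, hd₀⟩ := M.face_surjective M.outer
  -- Orthogonality makes both parts vanish separately, so by connectedness each potential is
  -- constant and determined by one value.
  have hkerle : Module.finrank ℚ (LinearMap.ker Φ) ≤ 2 := by
    let e : LinearMap.ker Φ →ₗ[ℚ] ℚ × ℚ :=
      { toFun := fun x => (x.1.1 d₀.fst, x.1.2 M.outer)
        map_add' := fun x y => rfl
        map_smul' := fun a x => rfl }
    have he : Function.Injective e := by
      rw [← LinearMap.ker_eq_bot, LinearMap.ker_eq_bot']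
      rintro ⟨⟨g, n⟩, hx⟩ hex
      obtain ⟨hg, hn⟩ := hker _ hx
      have hg0 : g d₀.fst = 0 := congrArg Prod.fst hex
      have hn0 : n M.outer = 0 := congrArg Prod.snd hex
      have hg' : ∀ d : G.Dart, g d.snd = g d.fst := by
        intro d
        by_cases h : black d.fst
        · exact hg ⟨d, h⟩
        · exact (hg ⟨d.symm, (hblack d).2 h⟩).symm
      have hn' : ∀ d : G.Dart, n (M.face d.symm) = n (M.face d) := by
        intro d
        by_cases h : black d.fst
        · exact (sub_eq_zero.1 (hn ⟨d, h⟩)).symm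
        · have := hn ⟨d.symm, (hblack d).2 h⟩
          simp only [T, SimpleGraph.Dart.symm_symm] at this
          exact sub_eq_zero.1 this
      have hgall : ∀ v, g v = 0 := by
        intro v
        obtain ⟨w⟩ := hconn.preconnected d₀.fst v
        rw [← hg0]
        clear hg0 hex hx
        generalize d₀.fst = u at w
        induction w with
        | nil => rfl
        | cons h _ ih => rw [ih]; exact hg' ⟨(_, _), h⟩
      have hnall : ∀ d, n (M.face d) = 0 :=
        dart_induction M.toRotationSystem hconn.preconnected (fun d h => (hn' d).trans h)
          (fun d h => by rw [M.face_rot, hn', h]) (d₀ := d₀) (by rw [hd₀]; exact hn0)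
      apply Subtype.ext
      refine Prod.ext (funext hgall) (funext fun f => ?_)
      obtain ⟨d, rfl⟩ := M.face_surjective f
      exact hnall d
    simpa using LinearMap.finrank_le_finrank_of_injective he
  have hcard : Fintype.card {d : G.Dart // black d.fst} = Nat.card G.edgeSet := by
    rw [← Nat.card_eq_fintype_card]
    refine Nat.card_congr (Equiv.ofBijective (fun d => ⟨d.1.edge, d.1.edge_mem⟩) ⟨?_, ?_⟩)
    · rintro ⟨d, hd⟩ ⟨d', hd'⟩ h
      rcases (SimpleGraph.dart_edge_eq_iff d d').1 (Subtype.ext_iff.1 h) with h | rfl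
      · exact Subtype.ext h
      · exact absurd hd' ((hblack d').1 hd)
    · rintro ⟨e, he⟩
      induction e using Sym2.ind with
      | _ x y =>
        by_cases hx : black x
        · exact ⟨⟨⟨(x, y), he⟩, hx⟩, rfl⟩
        · exact ⟨⟨⟨(y, x), SimpleGraph.Adj.symm he⟩, (hblack ⟨(x, y), he⟩).2 hx⟩,
            Subtype.ext Sym2.eq_swap⟩
  have hsurj : Function.Surjective Φ := by
    rw [← LinearMap.range_eq_top]
    apply Submodule.eq_top_of_finrank_eq
    have hrank := Φ.finrank_range_add_finrank_ker
    have hle := Submodule.finrank_le (LinearMap.range Φ)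
    have heuler := M.euler
    rw [Module.finrank_prod, Module.finrank_pi, Module.finrank_pi] at hrank
    rw [Module.finrank_pi] at hle ⊢
    rw [Nat.card_eq_fintype_card, Nat.card_eq_fintype_card (α := M.Face), ← hcard] at heuler
    omega
  obtain ⟨⟨g, n⟩, hx⟩ := hsurj fun d => c d
  have hx' : ∀ d : {d : G.Dart // black d.fst}, (g d.1.snd - g d.1.fst) + T n d = c d :=
    fun d => congrFun hx d
  have hc : ∑ d, g d.fst * c d = 0 := by
    rw [← Finset.sum_fiberwise Finset.univ (fun d : G.Dart => d.fst)]
    refine Finset.sum_eq_zero fun v _ => ?_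
    rw [← mul_zero (g v), ← hdiv v, Finset.mul_sum]
    exact Finset.sum_congr rfl fun d hd => by rw [(Finset.mem_filter.1 hd).2]
  -- The gradient part of c is orthogonal to c and to the face part, hence to itself; over ℚ it
  -- vanishes.
  have h0 : ∑ d : {d : G.Dart // black d.fst},
      (g d.1.snd - g d.1.fst) * (g d.1.snd - g d.1.fst) = 0 := by
    have h1 : ∑ d : {d : G.Dart // black d.fst},
        (g d.1.snd - g d.1.fst) * (g d.1.snd - g d.1.fst) =
        ∑ d : {d : G.Dart // black d.fst}, (g d.1.snd - g d.1.fst) * c d -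
          ∑ d : {d : G.Dart // black d.fst}, (g d.1.snd - g d.1.fst) * T n d := by
      rw [← Finset.sum_sub_distrib]
      refine Finset.sum_congr rfl fun d _ => ?_
      rw [← hx' d]
      ring
    rw [h1, horth, sum_grad_mul_eq_zero hblack g c hanti hc, sub_zero]
  have h1 : ∀ d : {d : G.Dart // black d.fst}, g d.1.snd - g d.1.fst = 0 := fun d =>
    mul_self_eq_zero.1
      ((Finset.sum_eq_zero_iff_of_nonneg fun d _ => mul_self_nonneg _).1 h0 d (Finset.mem_univ _))
  refine ⟨n, fun d => ?_⟩
  by_cases h : black d.fst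
  · rw [← hx' ⟨d, h⟩, h1 ⟨d, h⟩, zero_add]
  · have := hx' ⟨d.symm, (hblack d).2 h⟩
    rw [h1 ⟨d.symm, (hblack d).2 h⟩, zero_add, hTanti, hanti] at this
    exact (neg_injective this).symm

/-- The integral version, normalized to vanish on the outer face. -/
theorem exists_int_face_potential (hconn : G.Connected)
    (hblack : ∀ d : G.Dart, black d.snd ↔ ¬ black d.fst)
    (c : G.Dart → ℤ) (hanti : ∀ d, c d.symm = -c d)
    (hdiv : ∀ v, ∑ d : G.Dart with d.fst = v, c d = 0) :
    ∃ n : M.Face → ℤ, n M.outer = 0 ∧ ∀ d, c d = n (M.face d) - n (M.face d.symm) := by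
  obtain ⟨n, hn⟩ := exists_rat_face_potential M hconn hblack (fun d => (c d : ℚ))
    (fun d => by rw [hanti]; push_cast; rfl) (fun v => by exact_mod_cast hdiv v)
  obtain ⟨d₀, hd₀⟩ := M.face_surjective M.outer
  -- Crossing an edge changes n by the integer c, so differences from the outer value are integers.
  have hint : ∀ d, ∃ z : ℤ, n (M.face d) - n M.outer = z := by
    have hs : ∀ d, (∃ z : ℤ, n (M.face d) - n M.outer = z) →
        ∃ z : ℤ, n (M.face d.symm) - n M.outer = z := by
      rintro d ⟨z, hz⟩
      refine ⟨z - c d, ?_⟩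
      push_cast
      rw [← hz, hn d]
      ring
    refine dart_induction M.toRotationSystem hconn.preconnected hs
      (fun d h => by rw [M.face_rot]; exact hs d h) (d₀ := d₀) ⟨0, ?_⟩
    rw [hd₀]
    simp
  have hface : ∀ f, ∃ z : ℤ, n f - n M.outer = z := fun f => by
    obtain ⟨d, rfl⟩ := M.face_surjective f
    exact hint d
  choose z hz using hface
  refine ⟨z, ?_, fun d => ?_⟩
  · have := hz M.outer
    rw [sub_self] at this
    exact_mod_cast this.symm
  · have : ((c d : ℤ) : ℚ) = ((z (M.face d) - z (M.face d.symm) : ℤ) : ℚ) := by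
      push_cast
      rw [← hz, ← hz, hn d]
      ring
    exact_mod_cast this

end Homology

/-! ### Products of Kasteleyn signs around faces -/

section FaceProducts

variable {V : Type*} {G : SimpleGraph V} (M : PlaneEmbedding G) {black : V → Prop}

open scoped Classical

/-- The Kasteleyn sign of the edge of a dart. -/
noncomputable def dartSign (s : G.edgeSet → Circle) (d : G.Dart) : ℂ := s ⟨d.edge, d.edge_mem⟩

theorem dartSign_symm (s : G.edgeSet → Circle) (d : G.Dart) :
    dartSign s d.symm = dartSign s d := by
  unfold dartSign
  congr 3
  exact d.edge_symm

theorem dartSign_ne_zero (s : G.edgeSet → Circle) (d : G.Dart) : dartSign s d ≠ 0 :=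
  Circle.coe_ne_zero _

theorem black_iterate_faceNext (hblack : ∀ d : G.Dart, black d.snd ↔ ¬ black d.fst)
    {d₀ : G.Dart} (h₀ : black d₀.fst) (i : ℕ) : black (M.faceNext^[i] d₀).fst ↔ Even i := by
  induction i with
  | zero => simpa using h₀
  | succ i ih => rw [Function.iterate_succ_apply', M.faceNext_fst, hblack, ih, Nat.even_add_one]

variable [Fintype V] [DecidableRel G.Adj]

/-- The darts along a face, enumerated in cyclic order. -/
theorem filter_face_eq_image (hblack : ∀ d : G.Dart, black d.snd ↔ ¬ black d.fst)
    {d₀ : G.Dart} (h₀ : black d₀.fst) :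
    ∃ k, M.faceLength d₀ = 2 * k ∧
      (Finset.univ.filter fun d => M.face d = M.face d₀ ∧ black d.fst) =
        (Finset.range k).image (fun i => M.faceNext^[2 * i] d₀) ∧
      (Finset.univ.filter fun d => M.face d = M.face d₀ ∧ ¬ black d.fst) =
        (Finset.range k).image (fun i => M.faceNext^[2 * i + 1] d₀) ∧
      Set.InjOn (fun i => M.faceNext^[i] d₀) (Set.Iio (2 * k)) := by
  have hpos : 0 < M.faceLength d₀ :=
    Function.minimalPeriod_pos_of_mem_periodicPts (M.faceNext.injective.mem_periodicPts d₀)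
  have hper : M.faceNext^[M.faceLength d₀] d₀ = d₀ := Function.iterate_minimalPeriod
  have heven : Even (M.faceLength d₀) := by
    rw [← black_iterate_faceNext M hblack h₀, hper]
    exact h₀
  obtain ⟨k, hk⟩ := even_iff_two_dvd.1 heven
  have hface : ∀ i, M.face (M.faceNext^[i] d₀) = M.face d₀ := by
    intro i
    induction i with
    | zero => rfl
    | succ i ih => rw [Function.iterate_succ_apply', M.face_faceNext, ih]
  have hex : ∀ d, M.face d = M.face d₀ → ∃ i < 2 * k, M.faceNext^[i] d₀ = d := by
    intro d hd
    obtain ⟨i, hi⟩ := (M.face_eq_iff.1 hd.symm).exists_nat_pow_eq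
    refine ⟨i % M.faceLength d₀, hk ▸ Nat.mod_lt _ hpos, ?_⟩
    rw [← hi, Equiv.Perm.coe_pow]
    exact Function.iterate_mod_minimalPeriod_eq
  refine ⟨k, hk, ?_, ?_, hk ▸ Function.iterate_injOn_Iio_minimalPeriod⟩
  · ext d
    simp only [Finset.mem_filter, Finset.mem_univ, true_and, Finset.mem_image, Finset.mem_range]
    constructor
    · rintro ⟨hd, hb⟩
      obtain ⟨i, hi, rfl⟩ := hex d hd
      obtain ⟨j, rfl⟩ := even_iff_two_dvd.1 ((black_iterate_faceNext M hblack h₀ i).1 hb)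
      exact ⟨j, by omega, rfl⟩
    · rintro ⟨i, hi, rfl⟩
      exact ⟨hface _, (black_iterate_faceNext M hblack h₀ _).2 (even_two_mul i)⟩
  · ext d
    simp only [Finset.mem_filter, Finset.mem_univ, true_and, Finset.mem_image, Finset.mem_range]
    constructor
    · rintro ⟨hd, hb⟩
      obtain ⟨i, hi, rfl⟩ := hex d hd
      rw [black_iterate_faceNext M hblack h₀ i, Nat.not_even_iff_odd] at hb
      obtain ⟨j, rfl⟩ := hb
      exact ⟨j, by omega, rfl⟩
    · rintro ⟨i, hi, rfl⟩
      refine ⟨hface _, ?_⟩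
      rw [black_iterate_faceNext M hblack h₀, Nat.not_even_iff_odd]
      exact odd_two_mul_add_one i

/-- Tails alternate in colour along a face. Starting at a black tail, the numerator and denominator
of the Kasteleyn condition run over the darts with black and white tails. -/
theorem face_product (hblack : ∀ d : G.Dart, black d.snd ↔ ¬ black d.fst)
    {s : G.edgeSet → Circle} (hs : IsKasteleynSign M s) {f : M.Face} (hf : f ≠ M.outer) :
    (∏ d with M.face d = f ∧ black d.fst, dartSign s d) /
        (∏ d with M.face d = f ∧ ¬ black d.fst, dartSign s d) =
      (-1) ^ ((Finset.univ.filter fun d => M.face d = f ∧ black d.fst).card + 1) := by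
  obtain ⟨d₀, h₀, rfl⟩ : ∃ d, black d.fst ∧ M.face d = f := by
    obtain ⟨d, rfl⟩ := M.face_surjective f
    by_cases h : black d.fst
    · exact ⟨d, h, rfl⟩
    · exact ⟨M.faceNext d, by rwa [M.faceNext_fst, hblack], M.face_faceNext d⟩
  obtain ⟨k, hk, hb, hw, hinj⟩ := filter_face_eq_image M hblack h₀
  have hinjb : Set.InjOn (fun i => M.faceNext^[2 * i] d₀) (Finset.range k) := by
    intro i hi j hj hij
    have hi' : i < k := Finset.mem_range.1 hi
    have hj' : j < k := Finset.mem_range.1 hj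
    have := hinj (Set.mem_Iio.2 (by omega : 2 * i < 2 * k))
      (Set.mem_Iio.2 (by omega : 2 * j < 2 * k)) hij
    omega
  have hinjw : Set.InjOn (fun i => M.faceNext^[2 * i + 1] d₀) (Finset.range k) := by
    intro i hi j hj hij
    have hi' : i < k := Finset.mem_range.1 hi
    have hj' : j < k := Finset.mem_range.1 hj
    have := hinj (Set.mem_Iio.2 (by omega : 2 * i + 1 < 2 * k))
      (Set.mem_Iio.2 (by omega : 2 * j + 1 < 2 * k)) hij
    omega
  rw [hb, hw, Finset.prod_image hinjb, Finset.prod_image hinjw, Finset.card_image_of_injOn hinjb,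
    Finset.card_range]
  exact hs d₀ hf k hk

/-- The alternating product along the boundary of a combination of faces. -/
theorem prod_dartSign_zpow (hblack : ∀ d : G.Dart, black d.snd ↔ ¬ black d.fst)
    {s : G.edgeSet → Circle} (hs : IsKasteleynSign M s) [Fintype M.Face]
    (n : M.Face → ℤ) (hn : n M.outer = 0) :
    ∏ d with black d.fst, dartSign s d ^ (n (M.face d) - n (M.face d.symm)) =
      (-1) ^ ((Finset.univ.filter fun f => Odd (n f)).card +
        (Finset.univ.filter fun d => Odd (n (M.face d)) ∧ black d.fst).card) := by
  have h1 : ∏ d with black d.fst, dartSign s d ^ (n (M.face d) - n (M.face d.symm)) =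
      (∏ d with black d.fst, dartSign s d ^ n (M.face d)) /
        ∏ d with ¬ black d.fst, dartSign s d ^ n (M.face d) := by
    have h2 : ∏ d with ¬ black d.fst, dartSign s d ^ n (M.face d) =
        ∏ d with black d.fst, dartSign s d ^ n (M.face d.symm) := by
      refine Finset.prod_nbij' SimpleGraph.Dart.symm SimpleGraph.Dart.symm ?_ ?_ ?_ ?_ ?_
      · intro d hd
        simp only [Finset.mem_filter, Finset.mem_univ, true_and] at hd ⊢
        exact (hblack d).2 hd
      · intro d hd
        simp only [Finset.mem_filter, Finset.mem_univ, true_and] at hd ⊢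
        exact fun h => (hblack d).1 h hd
      · simp
      · simp
      · intro d _
        rw [dartSign_symm, SimpleGraph.Dart.symm_symm]
    rw [h2, ← Finset.prod_div_distrib]
    exact Finset.prod_congr rfl fun d _ => zpow_sub₀ (dartSign_ne_zero s d) _ _
  have h2 : ∀ (p : G.Dart → Prop) [DecidablePred p], ∏ d with p d, dartSign s d ^ n (M.face d) =
      ∏ f, (∏ d with M.face d = f ∧ p d, dartSign s d) ^ n f := by
    intro p _
    rw [← Finset.prod_fiberwise (Finset.univ.filter p) M.face]
    refine Finset.prod_congr rfl fun f _ => ?_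
    rw [← Finset.prod_zpow, Finset.filter_filter]
    refine Finset.prod_congr (by ext; simp [and_comm]) fun d hd => ?_
    rw [(Finset.mem_filter.1 hd).2.1]
  -- The ratio at a bounded face is ±1, so only the parity of n matters; the outer face carries no
  -- sign condition but has n = 0.
  have hodd : ∀ f, ((∏ d with M.face d = f ∧ black d.fst, dartSign s d) /
      (∏ d with M.face d = f ∧ ¬ black d.fst, dartSign s d)) ^ n f =
      if Odd (n f) then
        (-1) ^ ((Finset.univ.filter fun d => M.face d = f ∧ black d.fst).card + 1) else 1 := by
    intro f
    by_cases hf : f = M.outer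
    · rw [hf, hn]
      simp
    · rw [face_product M hblack hs hf]
      set m := (Finset.univ.filter fun d => M.face d = f ∧ black d.fst).card + 1
      have hsq : ((-1 : ℂ) ^ m) * (-1) ^ m = 1 := by rw [← mul_pow]; simp
      split_ifs with ho
      · obtain ⟨j, hj⟩ := ho
        rw [hj, zpow_add_one₀ (pow_ne_zero _ (by norm_num)), two_mul, zpow_add₀
          (pow_ne_zero _ (by norm_num)), ← mul_zpow, hsq, one_zpow, one_mul]
      · obtain ⟨j, hj⟩ := Int.not_odd_iff_even.1 ho
        rw [hj, zpow_add₀ (pow_ne_zero _ (by norm_num)), ← mul_zpow, hsq, one_zpow]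
  rw [h1, h2, h2, ← Finset.prod_div_distrib]
  simp_rw [← div_zpow, hodd]
  rw [← Finset.prod_filter, Finset.prod_pow_eq_pow_sum, Finset.sum_add_distrib, Finset.sum_const,
    smul_eq_mul, mul_one, add_comm]
  congr 2
  rw [Finset.card_eq_sum_card_fiberwise (f := M.face)
    (t := Finset.univ.filter fun f => Odd (n f)) (by intro d hd; simp at hd ⊢; exact hd.1)]
  refine Finset.sum_congr rfl fun f hf => ?_
  rw [Finset.filter_filter]
  congr 1
  ext d
  simp only [Finset.mem_filter, Finset.mem_univ, true_and] at hf ⊢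
  constructor
  · rintro ⟨rfl, hd⟩
    exact ⟨⟨hf, hd⟩, rfl⟩
  · rintro ⟨⟨-, hd⟩, rfl⟩
    exact ⟨rfl, hd⟩

end FaceProducts

/-! ### Kasteleyn's theorem for two matchings -/

section RelativeSigns

variable {V : Type*} {G : SimpleGraph V} {B W : Finset V}

theorem mem_snd_iff (hG : G.IsBipartiteWith (B : Set V) (W : Set V)) (d : G.Dart) :
    d.snd ∈ B ↔ d.fst ∉ B := by
  have hd := fun v (h : v ∈ B) (h' : v ∈ W) =>
    Set.disjoint_left.1 hG.disjoint (Finset.mem_coe.2 h) (Finset.mem_coe.2 h')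
  rcases hG.mem_of_adj d.adj with ⟨h1, h2⟩ | ⟨h1, h2⟩
  · have := fun h => hd _ h (Finset.mem_coe.1 h2)
    have := Finset.mem_coe.1 h1
    tauto
  · have := fun h => hd _ h (Finset.mem_coe.1 h1)
    have := Finset.mem_coe.1 h2
    tauto

variable [Fintype V] [DecidableEq V]

/-- The dart along which a vertex is matched by a bijection between black and white vertices. -/
def matchingDart (hBW : B ∪ W = Finset.univ) (π : B ≃ W) (hπ : ∀ b : B, G.Adj b (π b))
    (v : V) : G.Dart :=
  if hv : v ∈ B then ⟨(v, π ⟨v, hv⟩), hπ ⟨v, hv⟩⟩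
  else
    have hw : v ∈ W := (Finset.mem_union.1 (hBW ▸ Finset.mem_univ v)).resolve_left hv
    ⟨(v, π.symm ⟨v, hw⟩), by simpa using (hπ (π.symm ⟨v, hw⟩)).symm⟩

theorem matchingDart_fst (hBW : B ∪ W = Finset.univ) (π : B ≃ W) (hπ : ∀ b : B, G.Adj b (π b))
    (v : V) : (matchingDart hBW π hπ v).fst = v := by
  unfold matchingDart
  split_ifs <;> rfl

theorem matchingDart_coe (hBW : B ∪ W = Finset.univ) (π : B ≃ W)
    (hπ : ∀ b : B, G.Adj b (π b)) (b : B) :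
    matchingDart hBW π hπ b = ⟨(b, π b), hπ b⟩ := by
  simp [matchingDart]

theorem matchingDart_coe_white (hG : G.IsBipartiteWith (B : Set V) (W : Set V))
    (hBW : B ∪ W = Finset.univ) (π : B ≃ W) (hπ : ∀ b : B, G.Adj b (π b)) (w : W) :
    matchingDart hBW π hπ w = ⟨(w, π.symm w), by simpa using (hπ (π.symm w)).symm⟩ := by
  have : (w : V) ∉ B := fun h =>
    Set.disjoint_left.1 hG.disjoint (Finset.mem_coe.2 h) (Finset.mem_coe.2 w.2)
  simp [matchingDart, this]

theorem matchingDart_snd (hG : G.IsBipartiteWith (B : Set V) (W : Set V))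
    (hBW : B ∪ W = Finset.univ) (π : B ≃ W) (hπ : ∀ b : B, G.Adj b (π b)) (v : V) :
    matchingDart hBW π hπ (matchingDart hBW π hπ v).snd = (matchingDart hBW π hπ v).symm := by
  rcases Finset.mem_union.1 (hBW ▸ Finset.mem_univ v) with hv | hv
  · obtain ⟨b, rfl⟩ : ∃ b : B, (b : V) = v := ⟨⟨v, hv⟩, rfl⟩
    rw [matchingDart_coe, matchingDart_coe_white hG]
    ext <;> simp
  · obtain ⟨w, rfl⟩ : ∃ w : W, (w : V) = v := ⟨⟨v, hv⟩, rfl⟩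
    rw [matchingDart_coe_white hG, matchingDart_coe]
    ext <;> simp

/-- On black vertices ρ is π₂ followed by the inverse of π₁, the inverse of the permutation on the
right; inversion preserves signs. -/
theorem sign_restrict_black_eq (hG : G.IsBipartiteWith (B : Set V) (W : Set V))
    (hBW : B ∪ W = Finset.univ) {R : RotationSystem G} (P : MatchingRegion R) (π₁ π₂ : B ≃ W)
    (h₁ : ∀ b : B, G.Adj b (π₁ b)) (h₂ : ∀ b : B, G.Adj b (π₂ b))
    (hb : ∀ v, P.black v ↔ v ∈ B) (hm₁ : ∀ v, P.m₁ v = matchingDart hBW π₁ h₁ v)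
    (hm₂ : ∀ v, P.m₂ v = matchingDart hBW π₂ h₂ v) :
    (restrictPerm P.ρ P.black P.black_ρ).sign = Equiv.Perm.sign (π₁.trans π₂.symm) := by
  classical
  rw [restrictPerm, Equiv.Perm.sign_ofSubtype, ← Equiv.Perm.sign_inv (π₁.trans π₂.symm)]
  refine Equiv.Perm.sign_eq_sign_of_equiv _ _ (Equiv.subtypeEquivRight hb) fun b => ?_
  apply Subtype.ext
  obtain ⟨b, hbb⟩ := b
  have h2 : (P.m₂ b).snd = π₂ ⟨b, (hb b).1 hbb⟩ := by
    rw [hm₂, matchingDart_coe hBW π₂ h₂ ⟨b, (hb b).1 hbb⟩]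
  change (P.m₁ (P.m₂ b).snd).snd = π₁.symm (π₂ ⟨b, (hb b).1 hbb⟩)
  rw [h2, hm₁, matchingDart_coe_white hG]

/-- **Kasteleyn's theorem**: the relative sign of two perfect matchings is compensated by the
Kasteleyn signs of their edges. -/
theorem sign_mul_prod_kasteleynSign [DecidableRel G.Adj] (hconn : G.Connected)
    (hBW : B ∪ W = Finset.univ) (hG : G.IsBipartiteWith (B : Set V) (W : Set V))
    (M : PlaneEmbedding G) {s : G.edgeSet → Circle} (hs : IsKasteleynSign M s)
    (π₁ π₂ : B ≃ W) (h₁ : ∀ b : B, G.Adj b (π₁ b)) (h₂ : ∀ b : B, G.Adj b (π₂ b)) :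
    (((Equiv.Perm.sign (π₁.trans π₂.symm) : ℤˣ) : ℤ) : ℂ) *
        ∏ b : B, (s ⟨s(↑b, ↑(π₁ b)), h₁ b⟩ : ℂ) =
      ∏ b : B, (s ⟨s(↑b, ↑(π₂ b)), h₂ b⟩ : ℂ) := by
  classical
  let m₁ := matchingDart hBW π₁ h₁
  let m₂ := matchingDart hBW π₂ h₂
  have hfst₁ : ∀ v, (m₁ v).fst = v := matchingDart_fst hBW π₁ h₁
  have hfst₂ : ∀ v, (m₂ v).fst = v := matchingDart_fst hBW π₂ h₂
  have hsnd₁ : ∀ v, m₁ (m₁ v).snd = (m₁ v).symm := matchingDart_snd hG hBW π₁ h₁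
  have hsnd₂ : ∀ v, m₂ (m₂ v).snd = (m₂ v).symm := matchingDart_snd hG hBW π₂ h₂
  have hblack := mem_snd_iff hG
  have hsymm : ∀ m : V → G.Dart, (∀ v, m (m v).snd = (m v).symm) → ∀ d : G.Dart,
      d.symm = m d.symm.fst ↔ d = m d.fst := by
    intro m hm
    have h : ∀ d : G.Dart, d = m d.fst → d.symm = m d.symm.fst := by
      intro d hd
      have := hm d.fst
      rw [← hd] at this
      exact this.symm
    exact fun d => ⟨fun hd => by simpa using h _ hd, h d⟩
  let x : G.Dart → ℤ := fun d =>
    (if d = m₁ d.fst then 1 else 0) - (if d = m₂ d.fst then 1 else 0)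
  -- The difference of the matchings oriented from black to white. Each matching contributes one
  -- dart at every vertex, so the divergence is zero.
  let c : G.Dart → ℤ := fun d => if d.fst ∈ B then x d else -x d
  have hxs : ∀ d, x d.symm = x d := fun d => by
    simp only [x, hsymm m₁ hsnd₁ d, hsymm m₂ hsnd₂ d]
  have hanti : ∀ d, c d.symm = -c d := by
    intro d
    simp only [c, hxs]
    have := hblack d
    change (if d.snd ∈ B then _ else _) = _
    by_cases h : d.fst ∈ B <;> simp [h, this]
  have hdivx : ∀ v, ∑ d : G.Dart with d.fst = v, x d = 0 := by
    intro v
    have h : ∀ m : V → G.Dart, (∀ v, (m v).fst = v) →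
        ∑ d : G.Dart with d.fst = v, (if d = m d.fst then (1 : ℤ) else 0) = 1 := by
      intro m hm
      rw [Finset.sum_eq_single (m v)]
      · simp [hm]
      · intro d hd hne
        rw [(Finset.mem_filter.1 hd).2, if_neg hne]
      · intro h
        simp [hm] at h
    rw [Finset.sum_sub_distrib, h m₁ hfst₁, h m₂ hfst₂, sub_self]
  have hdiv : ∀ v, ∑ d : G.Dart with d.fst = v, c d = 0 := by
    intro v
    by_cases hv : v ∈ B
    · rw [← hdivx v]
      refine Finset.sum_congr rfl fun d hd => ?_
      simp only [c, (Finset.mem_filter.1 hd).2, hv, if_true]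
    · rw [← neg_eq_zero, ← hdivx v, ← Finset.sum_neg_distrib]
      refine Finset.sum_congr rfl fun d hd => ?_
      simp only [c, (Finset.mem_filter.1 hd).2, hv, if_false, neg_neg]
  obtain ⟨n, hn0, hn⟩ := exists_int_face_potential M hconn hblack c hanti
    (fun v => by convert hdiv v)
  have hfin : Finite M.Face := Finite.of_surjective _ M.face_surjective
  let _ : Fintype M.Face := Fintype.ofFinite _
  -- The flow is odd exactly on edges in one matching only, so these edges bound the set of faces
  -- where n is odd.
  have hpar : ∀ (p q r : Prop) [Decidable p] [Decidable q] [Decidable r],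
      Even (if r then ((if p then 1 else 0) - (if q then 1 else 0) : ℤ)
        else -((if p then 1 else 0) - (if q then 1 else 0))) ↔ (p ↔ q) := by
    intro p q r _ _ _
    by_cases p <;> by_cases q <;> by_cases r <;> simp [*]
  let P : MatchingRegion M.toRotationSystem :=
    { black := fun v => v ∈ B
      black_snd := hblack
      m₁ := m₁
      m₂ := m₂
      m₁_fst := hfst₁
      m₂_fst := hfst₂
      m₁_snd := hsnd₁
      m₂_snd := hsnd₂
      S := Finset.univ.filter fun f => Odd (n f)
      boundary := fun d => by
        have h1 : Even (c d) ↔ (d = m₁ d.fst ↔ d = m₂ d.fst) := by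
          exact hpar _ _ _
        rw [← h1, hn d, Int.even_sub']
        simp }
  have hperm : (restrictPerm P.ρ P.black P.black_ρ).sign = Equiv.Perm.sign (π₁.trans π₂.symm) := by
    exact sign_restrict_black_eq hG hBW P π₁ π₂ h₁ h₂ (fun _ => Iff.rfl) (fun _ => rfl) fun _ => rfl
  have hsign : Equiv.Perm.sign (π₁.trans π₂.symm) =
      (-1) ^ ((Finset.univ.filter fun f => Odd (n f)).card +
        (Finset.univ.filter fun d => Odd (n (M.face d)) ∧ d.fst ∈ B).card) := by
    rw [← hperm, P.sign_ρ_black]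
    congr! 4
    simp [MatchingRegion.Inside, P]
  have hprod : ∏ d with d.fst ∈ B, dartSign s d ^ (n (M.face d) - n (M.face d.symm)) =
      (-1) ^ ((Finset.univ.filter fun f => Odd (n f)).card +
        (Finset.univ.filter fun d => Odd (n (M.face d)) ∧ d.fst ∈ B).card) := by
    convert prod_dartSign_zpow M hblack hs n hn0
  have hratio : ∏ d with d.fst ∈ B, dartSign s d ^ (n (M.face d) - n (M.face d.symm)) =
      (∏ b : B, (s ⟨s(↑b, ↑(π₁ b)), h₁ b⟩ : ℂ)) / ∏ b : B, (s ⟨s(↑b, ↑(π₂ b)), h₂ b⟩ : ℂ) := by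
    have h : ∀ (π : B ≃ W) (hπ : ∀ b : B, G.Adj b (π b)),
        ∏ d with d.fst ∈ B, (if d = matchingDart hBW π hπ d.fst then dartSign s d else 1) =
          ∏ b : B, (s ⟨s(↑b, ↑(π b)), hπ b⟩ : ℂ) := by
      intro π hπ
      rw [← Finset.prod_filter, Finset.filter_filter]
      symm
      refine Finset.prod_bij (fun b _ => matchingDart hBW π hπ b) ?_ ?_ ?_ ?_
      · intro b _
        simp [matchingDart_fst]
      · intro b _ b' _ hbb
        have := congrArg (fun d : G.Dart => d.fst) hbb
        simp only [matchingDart_fst] at this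
        exact Subtype.ext this
      · intro d hd
        simp only [Finset.mem_filter, Finset.mem_univ, true_and] at hd
        exact ⟨⟨d.fst, hd.1⟩, Finset.mem_univ _, hd.2.symm⟩
      · intro b _
        rw [matchingDart_coe]
        rfl
    rw [← h π₁ h₁, ← h π₂ h₂, ← Finset.prod_div_distrib]
    refine Finset.prod_congr rfl fun d hd => ?_
    have hd' : d.fst ∈ B := (Finset.mem_filter.1 hd).2
    rw [← hn d]
    simp only [c, hd', if_true, x]
    rw [zpow_sub₀ (dartSign_ne_zero s d)]
    congr 1 <;> split_ifs <;> simp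
  rw [hratio] at hprod
  have hne : ∏ b : B, (s ⟨s(↑b, ↑(π₂ b)), h₂ b⟩ : ℂ) ≠ 0 :=
    Finset.prod_ne_zero_iff.2 fun b _ => Circle.coe_ne_zero _
  rw [hsign, (div_eq_iff hne).1 hprod]
  push_cast
  rw [← mul_assoc, ← mul_pow]
  simp

end RelativeSigns

/-! ### Dimer covers as bijections, and the determinant identity -/

section Covers

variable {V : Type*} {G : SimpleGraph V} {B W : Finset V}

theorem ends_of_mk (hG : G.IsBipartiteWith (B : Set V) (W : Set V)) (b : B) (w : W)
    (h : s((b : V), (w : V)) ∈ G.edgeSet) :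
    blackEnd hG ⟨_, h⟩ = b ∧ whiteEnd hG ⟨_, h⟩ = w := by
  have he := edge_eq_ends hG ⟨_, h⟩
  have hdisj : ∀ (b : B) (w : W), (b : V) ≠ w := fun b w hbw =>
    Set.disjoint_left.1 hG.disjoint (Finset.mem_coe.2 b.2) (Finset.mem_coe.2 (hbw ▸ w.2))
  rcases Sym2.eq_iff.1 he with ⟨h1, h2⟩ | ⟨h1, -⟩
  · exact ⟨Subtype.ext h1.symm, Subtype.ext h2.symm⟩
  · exact absurd h1 (hdisj _ _)

theorem mem_edge_black_iff (hG : G.IsBipartiteWith (B : Set V) (W : Set V)) (b : B)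
    (e : G.edgeSet) : (b : V) ∈ (e : Sym2 V) ↔ blackEnd hG e = b := by
  rw [edge_eq_ends hG e, Sym2.mem_iff]
  constructor
  · rintro (h | h)
    · exact Subtype.ext h.symm
    · exact absurd (Finset.mem_coe.2 (h ▸ (whiteEnd hG e).2))
        (Set.disjoint_left.1 hG.disjoint (Finset.mem_coe.2 b.2))
  · rintro rfl
    exact Or.inl rfl

theorem mem_edge_white_iff (hG : G.IsBipartiteWith (B : Set V) (W : Set V)) (w : W)
    (e : G.edgeSet) : (w : V) ∈ (e : Sym2 V) ↔ whiteEnd hG e = w := by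
  rw [edge_eq_ends hG e, Sym2.mem_iff]
  constructor
  · rintro (h | h)
    · exact absurd (Finset.mem_coe.2 w.2)
        (Set.disjoint_left.1 hG.disjoint (Finset.mem_coe.2 (h ▸ (blackEnd hG e).2)))
    · exact Subtype.ext h.symm
  · rintro rfl
    exact Or.inr rfl

theorem edge_ext (hG : G.IsBipartiteWith (B : Set V) (W : Set V)) {e e' : G.edgeSet}
    (h₁ : blackEnd hG e = blackEnd hG e') (h₂ : whiteEnd hG e = whiteEnd hG e') : e = e' := by
  apply Subtype.ext
  rw [edge_eq_ends hG e, edge_eq_ends hG e', h₁, h₂]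

theorem adj_ends (hG : G.IsBipartiteWith (B : Set V) (W : Set V)) (e : G.edgeSet) :
    G.Adj (blackEnd hG e) (whiteEnd hG e) := by
  have := e.2
  rwa [edge_eq_ends hG e] at this

open scoped Classical

/-- The dimer cover that consists of the edges from `b` to `π b`. -/
noncomputable def coverOf (π : B ≃ W) (hπ : ∀ b : B, G.Adj b (π b)) : Finset G.edgeSet :=
  Finset.univ.image fun b : B => ⟨s((b : V), (π b : V)), hπ b⟩

theorem mem_coverOf (hG : G.IsBipartiteWith (B : Set V) (W : Set V)) (π : B ≃ W)
    (hπ : ∀ b : B, G.Adj b (π b)) (e : G.edgeSet) :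
    e ∈ coverOf π hπ ↔ π (blackEnd hG e) = whiteEnd hG e := by
  simp only [coverOf, Finset.mem_image, Finset.mem_univ, true_and]
  constructor
  · rintro ⟨b, rfl⟩
    obtain ⟨h1, h2⟩ := ends_of_mk hG b (π b) (hπ b)
    rw [h1, h2]
  · intro h
    refine ⟨blackEnd hG e, Subtype.ext ?_⟩
    exact (congrArg (fun w : W => s((blackEnd hG e : V), (w : V))) h).trans
      (edge_eq_ends hG e).symm

theorem isDimerCover_coverOf [Fintype V] [DecidableEq V]
    (hG : G.IsBipartiteWith (B : Set V) (W : Set V)) (hBW : B ∪ W = Finset.univ) (π : B ≃ W)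
    (hπ : ∀ b : B, G.Adj b (π b)) : IsDimerCover (coverOf π hπ) := by
  intro v
  simp only [mem_coverOf hG]
  rcases Finset.mem_union.1 (hBW ▸ Finset.mem_univ v) with hv | hv
  · obtain ⟨b, rfl⟩ : ∃ b : B, (b : V) = v := ⟨⟨v, hv⟩, rfl⟩
    obtain ⟨h1, h2⟩ := ends_of_mk hG b (π b) (hπ b)
    simp only [mem_edge_black_iff hG]
    refine ⟨⟨_, hπ b⟩, ⟨by rw [h1, h2], h1⟩, ?_⟩
    rintro e ⟨he, rfl⟩
    exact edge_ext hG h1.symm (by rw [← he, h2])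
  · obtain ⟨w, rfl⟩ : ∃ w : W, (w : V) = v := ⟨⟨v, hv⟩, rfl⟩
    obtain ⟨b, rfl⟩ := π.surjective w
    obtain ⟨h1, h2⟩ := ends_of_mk hG b (π b) (hπ b)
    simp only [mem_edge_white_iff hG]
    refine ⟨⟨_, hπ b⟩, ⟨by rw [h1, h2], h2⟩, ?_⟩
    rintro e ⟨he, he'⟩
    exact edge_ext hG (by rw [h1]; exact π.injective (he.trans he')) (by rw [he', h2])

theorem exists_eq_coverOf (hG : G.IsBipartiteWith (B : Set V) (W : Set V))
    {C : Finset G.edgeSet} (hC : IsDimerCover C) :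
    ∃ (π : B ≃ W) (hπ : ∀ b : B, G.Adj b (π b)), coverOf π hπ = C := by
  choose e he huniq using hC
  have hb : ∀ b : B, blackEnd hG (e b) = b := fun b => (mem_edge_black_iff hG b _).1 (he b).2
  have hw : ∀ w : W, whiteEnd hG (e w) = w := fun w => (mem_edge_white_iff hG w _).1 (he w).2
  have hub : ∀ f ∈ C, f = e (blackEnd hG f) := fun f hf =>
    huniq _ f ⟨hf, (mem_edge_black_iff hG _ _).2 rfl⟩
  have huw : ∀ f ∈ C, f = e (whiteEnd hG f) := fun f hf =>
    huniq _ f ⟨hf, (mem_edge_white_iff hG _ _).2 rfl⟩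
  let π : B ≃ W :=
    { toFun := fun b => whiteEnd hG (e b)
      invFun := fun w => blackEnd hG (e w)
      left_inv := fun b => by
        change blackEnd hG (e (whiteEnd hG (e b))) = b
        rw [← huw _ (he b).1, hb]
      right_inv := fun w => by
        change whiteEnd hG (e (blackEnd hG (e w))) = w
        rw [← hub _ (he w).1, hw] }
  have hπ : ∀ b : B, G.Adj b (π b) := fun b => by
    have := adj_ends hG (e b)
    rwa [hb] at this
  refine ⟨π, hπ, ?_⟩
  ext f
  rw [mem_coverOf hG]
  change whiteEnd hG (e (blackEnd hG f)) = whiteEnd hG f ↔ _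
  constructor
  · intro h
    have : f = e (blackEnd hG f) := edge_ext hG (hb _).symm h.symm
    rw [this]
    exact (he _).1
  · intro h
    rw [← hub f h]

theorem coverOf_injective (hG : G.IsBipartiteWith (B : Set V) (W : Set V)) {π π' : B ≃ W}
    {hπ : ∀ b : B, G.Adj b (π b)} {hπ' : ∀ b : B, G.Adj b (π' b)}
    (h : coverOf π hπ = coverOf π' hπ') : π = π' := by
  ext b
  obtain ⟨h1, h2⟩ := ends_of_mk hG b (π b) (hπ b)
  have hmem : (⟨s((b : V), (π b : V)), hπ b⟩ : G.edgeSet) ∈ coverOf π' hπ' := by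
    rw [← h, mem_coverOf hG, h1, h2]
  rw [mem_coverOf hG, h1, h2] at hmem
  rw [hmem]

theorem prod_coverOf (π : B ≃ W) (hπ : ∀ b : B, G.Adj b (π b)) (ζ : G.edgeSet → ℂ)
    (hG : G.IsBipartiteWith (B : Set V) (W : Set V)) :
    ∏ e ∈ coverOf π hπ, ζ e = ∏ b : B, ζ ⟨s((b : V), (π b : V)), hπ b⟩ := by
  refine Finset.prod_image fun b _ b' _ hbb => ?_
  have h := congrArg (blackEnd hG) hbb
  simpa only [(ends_of_mk hG _ _ (hπ b)).1, (ends_of_mk hG _ _ (hπ b')).1] using h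

/-- The Kasteleyn matrix with complex edge weights `ζ`. -/
noncomputable def weightedKasteleyn (B W : Finset V) (s : G.edgeSet → Circle)
    (ζ : G.edgeSet → ℂ) : Matrix B W ℂ :=
  fun b w => if h : G.Adj b w then (s ⟨s(↑b, ↑w), h⟩ : ℂ) * ζ ⟨s(↑b, ↑w), h⟩ else 0

theorem kasteleyn_eq_weighted (s : G.edgeSet → Circle) (ν : G.edgeSet → ℝ) :
    kasteleyn B W s ν = weightedKasteleyn B W s fun e => (ν e : ℂ) := rfl

theorem weightedKasteleyn_ends (hG : G.IsBipartiteWith (B : Set V) (W : Set V))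
    (s : G.edgeSet → Circle) (ζ : G.edgeSet → ℂ) (e : G.edgeSet) :
    weightedKasteleyn B W s ζ (blackEnd hG e) (whiteEnd hG e) = s e * ζ e := by
  have he : (⟨s((blackEnd hG e : V), (whiteEnd hG e : V)), adj_ends hG e⟩ : G.edgeSet) = e :=
    Subtype.ext (edge_eq_ends hG e).symm
  rw [weightedKasteleyn, dif_pos (adj_ends hG e), he]

/-- The determinant of the Kasteleyn matrix is the partition function, up to a constant phase. -/
theorem exists_det_kasteleyn_eq [Fintype V] [DecidableEq V] [DecidableRel G.Adj]
    [Fintype G.edgeSet] (hconn : G.Connected) (hBW : B ∪ W = Finset.univ)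
    (hG : G.IsBipartiteWith (B : Set V) (W : Set V)) (M : PlaneEmbedding G)
    {s : G.edgeSet → Circle} (hs : IsKasteleynSign M s)
    (hcover : ∃ C : Finset G.edgeSet, IsDimerCover C) :
    ∃ (ω : ℂ) (π₀ : B ≃ W), ω ≠ 0 ∧ ∀ ζ : G.edgeSet → ℂ,
      ((weightedKasteleyn B W s ζ).submatrix id π₀).det =
        ω * ∑ C : Finset G.edgeSet with IsDimerCover C, ∏ e ∈ C, ζ e := by
  obtain ⟨C₀, hC₀⟩ := hcover
  obtain ⟨π₀, h₀, -⟩ := exists_eq_coverOf hG hC₀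
  refine ⟨∏ b : B, (s ⟨s(↑b, ↑(π₀ b)), h₀ b⟩ : ℂ), π₀,
    Finset.prod_ne_zero_iff.2 fun b _ => Circle.coe_ne_zero _, fun ζ => ?_⟩
  -- The Leibniz term of σ pairs row σ i with column π₀ i, so the black vertex b is matched to π₀
  -- (σ⁻¹ b).
  let e : Equiv.Perm B ≃ (B ≃ W) :=
    { toFun := fun σ => σ.symm.trans π₀
      invFun := fun π => π₀.trans π.symm
      left_inv := fun σ => by ext; simp
      right_inv := fun π => by ext; simp }
  have h1 : ((weightedKasteleyn B W s ζ).submatrix id π₀).det =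
      ∑ π : B ≃ W, (((Equiv.Perm.sign (π.trans π₀.symm) : ℤˣ) : ℤ) : ℂ) *
        ∏ b : B, weightedKasteleyn B W s ζ b (π b) := by
    rw [Matrix.det_apply', ← Equiv.sum_comp e]
    refine Finset.sum_congr rfl fun σ _ => ?_
    congr 1
    · have : (e σ).trans π₀.symm = σ⁻¹ := by ext; simp [e]
      rw [this, Equiv.Perm.sign_inv]
    · rw [← Equiv.prod_comp σ fun b => weightedKasteleyn B W s ζ b (e σ b)]
      refine Finset.prod_congr rfl fun b _ => ?_
      simp [e]
  rw [h1, Finset.mul_sum, ← Finset.sum_filter_of_ne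
    (p := fun π : B ≃ W => ∀ b : B, G.Adj b (π b))]
  · refine Finset.sum_bij (fun π hπ => coverOf π (Finset.mem_filter.1 hπ).2) ?_ ?_ ?_ ?_
    · intro π hπ
      exact Finset.mem_filter.2 ⟨Finset.mem_univ _, isDimerCover_coverOf hG hBW π _⟩
    · intro π _ π' _ h
      exact coverOf_injective hG h
    · intro C hC
      obtain ⟨π, hπ, h⟩ := exists_eq_coverOf hG (Finset.mem_filter.1 hC).2
      exact ⟨π, Finset.mem_filter.2 ⟨Finset.mem_univ _, hπ⟩, h⟩
    · intro π hπ
      have hπ' := (Finset.mem_filter.1 hπ).2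
      rw [prod_coverOf π hπ' ζ hG, ← sign_mul_prod_kasteleynSign hconn hBW hG M hs π π₀ hπ' h₀,
        mul_assoc, ← Finset.prod_mul_distrib]
      congr 1
      exact Finset.prod_congr rfl fun b _ => dif_pos (hπ' b)
  · intro π _ hne b
    by_contra hb
    refine hne (mul_eq_zero_of_right _ (Finset.prod_eq_zero (Finset.mem_univ b) ?_))
    exact dif_neg hb

theorem sum_blackEnd_eq [DecidableEq V] [Fintype G.edgeSet]
    (hG : G.IsBipartiteWith (B : Set V) (W : Set V))
    (F : G.edgeSet → ℂ) (H : W → ℂ) (b : B) :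
    ∑ e, (if b = blackEnd hG e then F e * H (whiteEnd hG e) else 0) =
      ∑ w : W, (if h : G.Adj b w then F ⟨s(↑b, ↑w), h⟩ else 0) * H w := by
  rw [← Finset.sum_fiberwise Finset.univ (whiteEnd hG)]
  refine Finset.sum_congr rfl fun w _ => ?_
  by_cases h : G.Adj b w
  · obtain ⟨h1, h2⟩ := ends_of_mk hG b w h
    rw [dif_pos h, Finset.sum_eq_single ⟨s(↑b, ↑w), h⟩]
    · rw [h1, h2, if_pos rfl]
    · intro e he hne
      refine if_neg fun hb => hne (edge_ext hG (h1 ▸ hb).symm ?_)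
      rw [h2, (Finset.mem_filter.1 he).2]
    · intro hn
      exact (hn (Finset.mem_filter.2 ⟨Finset.mem_univ _, h2⟩)).elim
  · rw [dif_neg h, zero_mul]
    refine Finset.sum_eq_zero fun e he => if_neg fun hb => h ?_
    rw [hb, ← (Finset.mem_filter.1 he).2]
    exact adj_ends hG e

/-- The generating function of the dimer model is a Fredholm determinant. -/
theorem det_one_sub_mul_inverse [DecidableEq V] [Fintype G.edgeSet] [DecidableEq G.edgeSet]
    (hG : G.IsBipartiteWith (B : Set V) (W : Set V)) (s : G.edgeSet → Circle)
    (ζ φ : G.edgeSet → ℂ) (Kinv : Matrix W B ℂ) :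
    (1 - weightedKasteleyn B W s (fun e => ζ e * φ e) * Kinv).det =
      (1 - Matrix.diagonal φ * Matrix.of fun e f : G.edgeSet =>
        weightedKasteleyn B W s ζ (blackEnd hG e) (whiteEnd hG e) *
          Kinv (whiteEnd hG e) (blackEnd hG f)).det := by
  -- Factor through the edges: P is the incidence of black ends and Q carries weights and inverse.
  -- Then det(1 - PQ) = det(1 - QP) moves the determinant from black vertices to edges.
  let P : Matrix B G.edgeSet ℂ := Matrix.of fun b e => if b = blackEnd hG e then 1 else 0
  let Q : Matrix G.edgeSet B ℂ := Matrix.of fun e b =>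
    s e * (ζ e * φ e) * Kinv (whiteEnd hG e) b
  have h1 : weightedKasteleyn B W s (fun e => ζ e * φ e) * Kinv = P * Q := by
    ext b b'
    rw [Matrix.mul_apply, Matrix.mul_apply]
    have := sum_blackEnd_eq hG (fun e => s e * (ζ e * φ e)) (fun w => Kinv w b') b
    simp only [P, Q, Matrix.of_apply, ite_mul, one_mul, zero_mul]
    exact this.symm
  have h2 : Matrix.diagonal φ * Matrix.of (fun e f : G.edgeSet =>
      weightedKasteleyn B W s ζ (blackEnd hG e) (whiteEnd hG e) *
        Kinv (whiteEnd hG e) (blackEnd hG f)) = Q * P := by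
    ext e f
    rw [Matrix.diagonal_mul, Matrix.mul_apply]
    simp only [P, Q, Matrix.of_apply, mul_ite, mul_one, mul_zero, Finset.sum_ite_eq',
      Finset.mem_univ, if_true, weightedKasteleyn_ends]
    ring
  rw [h1, h2, Matrix.det_one_sub_mul_comm]

theorem partitionFunction_pos [Fintype G.edgeSet] {ν : G.edgeSet → ℝ} (hν : ∀ e, 0 < ν e)
    (hcover : ∃ C : Finset G.edgeSet, IsDimerCover C) : 0 < partitionFunction ν := by
  obtain ⟨C, hC⟩ := hcover
  exact Finset.sum_pos (fun C _ => Finset.prod_pos fun e _ => hν e)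
    ⟨C, Finset.mem_filter.2 ⟨Finset.mem_univ _, hC⟩⟩

theorem isPointProcess_dimerProb [Fintype G.edgeSet] {ν : G.edgeSet → ℝ} (hν : ∀ e, 0 < ν e)
    (hcover : ∃ C : Finset G.edgeSet, IsDimerCover C) : IsPointProcess (dimerProb ν) := by
  have hZ := partitionFunction_pos hν hcover
  refine ⟨fun C => ?_, ?_⟩
  · unfold dimerProb
    split_ifs
    · exact div_nonneg (Finset.prod_nonneg fun e _ => (hν e).le) hZ.le
    · exact le_rfl
  · unfold dimerProb
    rw [← Finset.sum_filter, ← Finset.sum_div]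
    exact div_self hZ.ne'

theorem sum_dimerProb_mul_prod [Fintype G.edgeSet] (ν : G.edgeSet → ℝ) (ψ : G.edgeSet → ℂ) :
    ∑ C : Finset G.edgeSet, (dimerProb ν C : ℂ) * ∏ e ∈ C, ψ e =
      (∑ C : Finset G.edgeSet with IsDimerCover C, ∏ e ∈ C, (ν e * ψ e : ℂ)) /
        partitionFunction ν := by
  rw [Finset.sum_filter, Finset.sum_div]
  refine Finset.sum_congr rfl fun C _ => ?_
  unfold dimerProb
  split_ifs
  · rw [Finset.prod_mul_distrib, weight]
    push_cast
    ring
  · simp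

end Covers

end DimerModel

/-! ### Inverse, edge probabilities and determinantal structure -/

theorem mainTheorem8 {V : Type*} [Fintype V] [DecidableEq V] (G : SimpleGraph V)
    [DecidableRel G.Adj] (hconn : G.Connected) (hcut : DimerModel.NoCutPoints G)
    (B W : Finset V) (hBW : B ∪ W = Finset.univ)
    (hG : G.IsBipartiteWith (B : Set V) (W : Set V))
    (M : DimerModel.PlaneEmbedding G)
    (ν : G.edgeSet → ℝ) (hν : ∀ e, 0 < ν e)
    (s : G.edgeSet → Circle) (hs : DimerModel.IsKasteleynSign M s)
    (hcover : ∃ C : Finset G.edgeSet, DimerModel.IsDimerCover C) :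
    ∃ Kinv : Matrix W B ℂ,
      (DimerModel.kasteleyn B W s ν * Kinv = 1 ∧ Kinv * DimerModel.kasteleyn B W s ν = 1) ∧
      (∀ (r : ℕ) (e : Fin r → G.edgeSet), Function.Injective e →
        (DimerModel.edgeProb ν e : ℂ) =
          (∏ i, DimerModel.kasteleyn B W s ν (DimerModel.blackEnd hG (e i))
            (DimerModel.whiteEnd hG (e i))) *
          Matrix.det (Matrix.of fun i j : Fin r =>
            Kinv (DimerModel.whiteEnd hG (e i)) (DimerModel.blackEnd hG (e j)))) ∧
      DimerModel.IsDeterminantal (DimerModel.dimerProb ν) (fun e f : G.edgeSet =>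
        DimerModel.kasteleyn B W s ν (DimerModel.blackEnd hG e) (DimerModel.whiteEnd hG e) *
          Kinv (DimerModel.whiteEnd hG e) (DimerModel.blackEnd hG f)) := by
  classical
  open DimerModel in
  obtain ⟨ω, π₀, hω, hdet⟩ := exists_det_kasteleyn_eq hconn hBW hG M hs hcover
  have hZ : (partitionFunction ν : ℂ) ≠ 0 := by
    exact_mod_cast (partitionFunction_pos hν hcover).ne'
  -- Rows and columns have different index types; a matching bijection makes the matrix square with
  -- a determinant.
  set N := (kasteleyn B W s ν).submatrix id π₀ with hN
  have hNdet : N.det = ω * partitionFunction ν := by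
    rw [hN, kasteleyn_eq_weighted, hdet, partitionFunction]
    push_cast [weight]
    rfl
  have hunit : IsUnit N.det := by
    rw [hNdet]
    exact (mul_ne_zero hω hZ).isUnit
  set Kinv : Matrix W B ℂ := N⁻¹.submatrix π₀.symm id with hKinv
  have hK : kasteleyn B W s ν = N.submatrix id π₀.symm := by
    ext b w
    simp [hN]
  have hright : kasteleyn B W s ν * Kinv = 1 := by
    rw [hK, hKinv, Matrix.submatrix_mul_equiv, Matrix.mul_nonsing_inv _ hunit,
      Matrix.submatrix_id_id]
  have hleft : Kinv * kasteleyn B W s ν = 1 := by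
    rw [hK, hKinv, ← Matrix.submatrix_mul _ _ _ _ _ Function.bijective_id,
      Matrix.nonsing_inv_mul _ hunit, Matrix.submatrix_one_equiv]
  have hgen : ∀ φ : G.edgeSet → ℂ, ∑ C : Finset G.edgeSet, (dimerProb ν C : ℂ) *
      ∏ e ∈ C, (1 - φ e) = (1 - Matrix.diagonal φ * Matrix.of fun e f : G.edgeSet =>
        kasteleyn B W s ν (blackEnd hG e) (whiteEnd hG e) *
          Kinv (whiteEnd hG e) (blackEnd hG f)).det := by
    intro φ
    rw [kasteleyn_eq_weighted, ← det_one_sub_mul_inverse, sum_dimerProb_mul_prod,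
      div_eq_iff hZ]
    have h1 := hdet fun e => ν e * (1 - φ e)
    -- Linearity in the weights gives K_{ν(1-φ)} = K_ν - K_{νφ}; factoring out N on the right leaves
    -- 1 - K_{νφ} K⁻¹.
    have h2 : (weightedKasteleyn B W s fun e => ν e * (1 - φ e)).submatrix id π₀ =
        (1 - weightedKasteleyn B W s (fun e => ν e * φ e) * Kinv) * N := by
      rw [Matrix.sub_mul, Matrix.one_mul, Matrix.mul_assoc]
      have h3 : Kinv * N = (1 : Matrix W W ℂ).submatrix id π₀ := by
        rw [← hleft, hN]
        ext w b
        simp [Matrix.mul_apply]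
      rw [h3]
      ext b b'
      simp only [hN, Matrix.sub_apply, Matrix.submatrix_apply, id, Matrix.mul_apply,
        Matrix.one_apply, mul_ite, mul_one, mul_zero, Finset.sum_ite_eq', Finset.mem_univ, if_true,
        kasteleyn_eq_weighted, weightedKasteleyn]
      split_ifs <;> ring
    rw [h2, Matrix.det_mul, hNdet] at h1
    apply mul_left_cancel₀ hω
    rw [← h1]
    ring
  set L : G.edgeSet → G.edgeSet → ℂ := fun e f =>
    kasteleyn B W s ν (blackEnd hG e) (whiteEnd hG e) * Kinv (whiteEnd hG e) (blackEnd hG f) with hL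
  refine ⟨Kinv, ⟨hright, hleft⟩, fun r e he => ?_, isPointProcess_dimerProb hν hcover,
    hasCorrelationFunctions_of_det (dimerProb ν) L hgen⟩
  have h1 := sum_superset_eq_minor (fun C => (dimerProb ν C : ℂ)) (Matrix.of L) hgen
    (Finset.univ.image e)
  rw [minor_eq_det_of_injective _ e he] at h1
  -- The factor K(bᵢ, wᵢ) depends on the row only, so it can be absorbed into the determinant.
  rw [← Matrix.det_mul_column]
  refine Eq.trans ?_ h1
  rw [edgeProb]
  push_cast
  refine Finset.sum_congr ?_ fun _ _ => rfl
  ext C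
  simp [Finset.subset_iff]
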